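/- Let $f:\mathbb{R}\to\mathbb{R}$ be piecewise smooth: $\mathbb{R}$ is a finite disjoint union of intervals, on each of which $f$ is continuously differentiable and either strictly monotone or constant. Let $Z\sim\mathcal N(0,1)$ and assume that the entropy $H(\lfloor f(Z)\rfloor)$ is finite. The information dimension of a real random variable $X$ is $d(X)=\lim_{M\to\infty}H(\lfloor MX\rfloor/M)/\log M$, if this limit exists. *State evolution.* For $v\in(0,1]$ let $$\mathsf{mmse}_z(v)=\mathbb{E}\Big[\big(Z-\mathbb{E}[Z\mid \sqrt{v^{-1}-1}\,Z+N,\;f(Z)]\big)^2\Big],\qquad \phi(v)=\Big(\frac1{\mathsf{mmse}_z(v)}-\frac1v\Big)^{-1}\in[0,\infty],$$ where $N\sim\mathcal N(0,1)$ is independent of $Z$, and $\phi(0)=\lim_{v\to0+}\phi(v)$. An eigenvalue distribution is a probability measure $P_\lambda$ whose support is a compact subset of $(0,\infty)$; it is understood up to scale, and at sampling ratio $\delta>1$ it is normalized by a scale factor so that $\mathbb{E}[\lambda]=\delta$. With this normalization let $$\Phi(v)=\Big(\frac{1}{\frac1\delta\,\mathbb{E}\left[\frac{v\lambda}{v+\lambda}\right]}-\frac1v\Big)^{-1},\qquad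 \mathsf{MSE}_\lambda(v)=\mathbb{E}\Big[\frac{v}{v+\lambda}\Big]\qquad(v\in[0,\infty]),$$ where $v=0$ and $v=\infty$ are understood as limits. Put $V_r^{-1}=1$, $V_l^t=\phi(V_r^{t-1})$ and $V_r^t=\Phi(V_l^t)$ for $t\ge0$, let $V_r^\star=\lim_{t\to\infty}V_r^t$, and let $\mathsf{MSE}^\star_\lambda=\mathsf{MSE}_\lambda(\phi(V_r^\star))$ be the predicted final mean squared error. The perfect recovery threshold is $$\delta^{\mathsf p}_\lambda=\inf\{\delta>1:\ \mathsf{MSE}^\star_\lambda=0\}\in[1,\infty].$$ *Lorenz order.* For a nonnegative random variable with distribution function $F$, let $F^{-1}(y)=\sup\{x:F(x)\le y\}$ for $0<y<1$, and let $L(u)=\int_0^uF^{-1}(y)\,dy\big/\int_0^1F^{-1}(y)\,dy$ for $0\le u\le1$. Then $\lambda_1$ is spikier than $\lambda_2$, written $\lambda_1\succeq_L\lambda_2$, if $L_{\lambda_1}(u)\le L_{\lambda_2}(u)$ for all $u\in[0,1]$. **Theorem.** (i) For all eigenvalue distributions, if $\lambda_1\succeq_L\lambda_2$, then $\delta^{\mathsf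 p}_{\lambda_1}\le\delta^{\mathsf p}_{\lambda_2}$. (ii) Assume in addition that $f'\neq0$ almost everywhere on the intervals on which $f$ is strictly monotone. Then $d(f(Z))$ exists. If moreover $\mathsf{mmse}_z(1)<1$ and $\delta^{\mathsf p}_{\mathrm{opt}}:=1/d(f(Z))<\infty$, then for every $\varepsilon>0$ there is an eigenvalue distribution, which can be chosen with exactly two atoms and no other mass, such that $$\delta^{\mathsf p}_{\mathrm{opt}}\le\delta^{\mathsf p}_\lambda<\delta^{\mathsf p}_{\mathrm{opt}}+\varepsilon .$$ -/

import Mathlib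

open MeasureTheory ProbabilityTheory Set Filter Topology
open scoped ENNReal

noncomputable section

namespace GLMEP

/-! ### Entropy and information dimension -/

/-- Shannon entropy of an integer-valued random variable with law `ρ`, with values in `[0, ∞]`. -/
def entropy (ρ : Measure ℤ) : ℝ≥0∞ :=
  ∑' k : ℤ, ENNReal.ofReal (Real.negMulLog (ρ.real {k}))

/-- Law of `⌊M X⌋` when `X` has law `μ`. It has the same entropy as the quantization
`⌊M X⌋ / M`, because division by `M` is injective on the integers. -/
def quantizedLaw (μ : Measure ℝ) (M : ℕ) : Measure ℤ :=
  μ.map (fun x : ℝ => ⌊(M : ℝ) * x⌋)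

/-- The information dimension of a real random variable with law `μ` exists and equals `d`. -/
def HasInfoDim (μ : Measure ℝ) (d : ℝ≥0∞) : Prop :=
  Tendsto (fun M : ℕ => entropy (quantizedLaw μ M) / ENNReal.ofReal (Real.log (M : ℝ)))
    atTop (𝓝 d)

/-! ### Conditions on the nonlinearity -/

/-- `ℝ` is a finite disjoint union of intervals, on each of which `f` is continuously
differentiable and either strictly monotone or constant. -/
def PiecewiseSmooth (f : ℝ → ℝ) : Prop :=
  ∃ (K : ℕ) (I : Fin K → Set ℝ),
    (∀ k, (I k).OrdConnected) ∧
    Pairwise (fun j k => Disjoint (I j) (I k)) ∧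
    (⋃ k, I k) = univ ∧
    ∀ k, ContDiffOn ℝ 1 f (I k) ∧
      (StrictMonoOn f (I k) ∨ StrictAntiOn f (I k) ∨ ∃ c, ∀ x ∈ I k, f x = c)

/-- For almost every `x`: if `f' x = 0` then `f` is constant near `x`. For a piecewise smooth `f`
this says that `f' ≠ 0` almost everywhere on the intervals of strict monotonicity, i.e. that
`f(Z)` has an absolutely continuous law outside of the flat sections of `f`. -/
def NonflatRegular (f : ℝ → ℝ) : Prop :=
  ∀ᵐ x : ℝ, deriv f x = 0 → ∀ᶠ y in 𝓝 x, f y = f x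

/-! ### Minimum mean squared errors -/

/-- `mmse(Z, snr | U) = 𝔼 (Z - 𝔼[Z | √snr Z + N, U])²` for random variables `Z`, `U` on `(Ω, μ)`
and a standard Gaussian `N` independent of `(Z, U)`, realised as the second coordinate of
`Ω × ℝ`. -/
def condMMSE {Ω : Type*} [MeasurableSpace Ω] (μ : Measure Ω) (Z U : Ω → ℝ) (snr : ℝ) : ℝ :=
  ∫ ω : Ω × ℝ, (Z ω.1 -
    condExp
      (MeasurableSpace.comap (fun ω' : Ω × ℝ => (√snr * Z ω'.1 + ω'.2, U ω'.1)) inferInstance)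
      (μ.prod (gaussianReal 0 1)) (fun ω' : Ω × ℝ => Z ω'.1) ω) ^ 2 ∂(μ.prod (gaussianReal 0 1))

/-- `mmse_z(v) = mmse(Z, v⁻¹ - 1 | f(Z))` with `Z` standard Gaussian; used for `v ∈ (0, 1]`. -/
def mmseZ (f : ℝ → ℝ) (v : ℝ≥0∞) : ℝ≥0∞ :=
  ENNReal.ofReal (condMMSE (gaussianReal 0 1) id f (v.toReal⁻¹ - 1))

/-! ### Eigenvalue distributions -/

/-- Probability measures with compact support contained in `(0, ∞)`. -/
def IsEigenvalueLaw (ν : Measure ℝ) : Prop :=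
  IsProbabilityMeasure ν ∧ ∃ a b : ℝ, 0 < a ∧ ν (Icc a b)ᶜ = 0

/-- The eigenvalue distribution `ν` rescaled to have mean `δ`. -/
def spectrumAt (ν : Measure ℝ) (δ : ℝ) : Measure ℝ :=
  ν.map (fun x : ℝ => δ / (∫ y, y ∂ν) * x)

/-! ### State evolution

The variances take values in `[0, ∞]`, where `0⁻¹ = ∞` and `∞⁻¹ = 0`. -/

/-- `φ(v) = (1 / mmse_z(v) - 1 / v)⁻¹` for `v ∈ (0, 1]`, and `φ(0) = lim_{v → 0+} φ(v)` (the
limit exists because `φ` is nondecreasing on `(0, 1]`). -/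
def phi (f : ℝ → ℝ) (v : ℝ≥0∞) : ℝ≥0∞ :=
  if v = 0 then limsup (fun u : ℝ≥0∞ => ((mmseZ f u)⁻¹ - u⁻¹)⁻¹) (𝓝[>] 0)
  else ((mmseZ f v)⁻¹ - v⁻¹)⁻¹

/-- `Φ(v) = (1 / (δ⁻¹ 𝔼[v λ / (v + λ)]) - 1 / v)⁻¹` for `λ` of law `P`, with `Φ(0) = 0`. The
integrand is written as `(1 / v + 1 / λ)⁻¹`, which has the correct value `λ` at `v = ∞`. -/
def Phi (P : Measure ℝ) (δ : ℝ) (v : ℝ≥0∞) : ℝ≥0∞ :=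
  if v = 0 then 0
  else (((ENNReal.ofReal δ)⁻¹ * ∫⁻ x, (v⁻¹ + (ENNReal.ofReal x)⁻¹)⁻¹ ∂P)⁻¹ - v⁻¹)⁻¹

/-- `MSE_λ(v) = 𝔼[v / (v + λ)]` for `λ` of law `P`. The integrand is written as
`(1 + λ / v)⁻¹`, which has the correct value `1` at `v = ∞`. -/
def mse (P : Measure ℝ) (v : ℝ≥0∞) : ℝ≥0∞ :=
  ∫⁻ x, (1 + ENNReal.ofReal x / v)⁻¹ ∂P

/-- The sequence `V_r` of the state evolution at sampling ratio `δ`, started at `1`: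
`V_l^t = φ(V_r^{t-1})` and `V_r^t = Φ(V_l^t)`. The index is shifted: `seVr f ν δ t` is
`V_r^{t-1}`. The eigenvalue distribution is normalized to have mean `δ`. -/
def seVr (f : ℝ → ℝ) (ν : Measure ℝ) (δ : ℝ) : ℕ → ℝ≥0∞
  | 0 => 1
  | t + 1 => Phi (spectrumAt ν δ) δ (phi f (seVr f ν δ t))

/-- The limit `V_r^⋆` of the sequence `V_r` (which is nonincreasing for `δ > 1`, so that its upper
limit is its limit). -/
def vrStar (f : ℝ → ℝ) (ν : Measure ℝ) (δ : ℝ) : ℝ≥0∞ :=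
  limsup (seVr f ν δ) atTop

/-- The final mean squared error `MSE^⋆ = MSE_λ(φ(V_r^⋆))` predicted by the state evolution. -/
def mseStar (f : ℝ → ℝ) (ν : Measure ℝ) (δ : ℝ) : ℝ≥0∞ :=
  mse (spectrumAt ν δ) (phi f (vrStar f ν δ))

/-- The perfect recovery threshold: the infimum (`∞` if there is none) of the sampling ratios
`δ > 1` at which the predicted final mean squared error is zero. -/
def threshold (f : ℝ → ℝ) (ν : Measure ℝ) : ℝ≥0∞ :=
  sInf (ENNReal.ofReal '' {δ : ℝ | 1 < δ ∧ mseStar f ν δ = 0})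

/-! ### Lorenz order -/

/-- The quantile function `F⁻¹(y) = sup {x | F(x) ≤ y}`, `0 < y < 1`. -/
def quantile (ν : Measure ℝ) (y : ℝ) : ℝ :=
  sSup {x : ℝ | cdf ν x ≤ y}

/-- The Lorenz curve. -/
def lorenz (ν : Measure ℝ) (u : ℝ) : ℝ :=
  (∫ y in (0 : ℝ)..u, quantile ν y) / ∫ y in (0 : ℝ)..1, quantile ν y

/-- `ν₁` is spikier than `ν₂` in the Lorenz order. -/
def Spikier (ν₁ ν₂ : Measure ℝ) : Prop :=
  ∀ u ∈ Icc (0 : ℝ) 1, lorenz ν₁ u ≤ lorenz ν₂ u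

end GLMEP

end

noncomputable section

/-!
Part (i) holds because `MSE^⋆` vanishes exactly when the iterates of `Φ ∘ φ` tend to `0`, `Φ` and
`φ` are nondecreasing, and a spikier spectrum lowers `Φ` pointwise: `Φ` depends on the spectrum
through the mean of the concave function `λ ↦ vλ / (v + λ)`, and the Lorenz order is majorization
of quantile functions. The maps are nondecreasing because a better measurement of `Z` can be
degraded to a worse one by adding noise and averaging with the prior.

Part (ii) rests on the linearization at `v = 0`. In terms of the noise `W`, the error
`mmse_z(v) / v` tends to `P(Z ∈ F)`, where `F` is the set of points near which `f` is constant: on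
`F` the value `f(Z)` does not help, and elsewhere `f` can be inverted locally and reveals `Z`.
Hence `φ` has the slope `P(F) / P(Fᶜ)` at `0`, while `Φ` has the slope `1 / (δ - 1)` there and lies
below its tangent, whatever the spectrum. So perfect recovery needs `δ ≥ 1 / P(Fᶜ)`, and above this
value it happens as soon as the first iterate is small, which a rare large eigenvalue next to
very small ones achieves. Finally `P(Fᶜ)` is the information dimension of `f(Z)`, by Rényi's theorem
on mixtures of an absolutely continuous and a finitely supported law.
-/

namespace GLMEP

/-! ### Parallel sums in `[0, ∞]` -/

/-- The variance left in an estimate of variance `m` once a prior of variance `v` is removed from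
it; both maps of the state evolution have this form. -/
def extrinsic (m v : ℝ≥0∞) : ℝ≥0∞ := (m⁻¹ - v⁻¹)⁻¹

theorem extrinsic_mono_left (v : ℝ≥0∞) : Monotone fun m => extrinsic m v := fun _ _ h =>
  ENNReal.inv_le_inv.2 (tsub_le_tsub_right (ENNReal.inv_le_inv.2 h) _)

theorem extrinsic_le_extrinsic {m m' u v : ℝ≥0∞} (hu : u ≠ 0) (huv : u ≤ v)
    (h : m'⁻¹ + (u⁻¹ - v⁻¹) ≤ m⁻¹) : extrinsic m u ≤ extrinsic m' v := by
  have hu' : u⁻¹ ≠ ⊤ := ENNReal.inv_ne_top.2 hu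
  refine ENNReal.inv_le_inv.2 ?_
  calc m'⁻¹ - v⁻¹ = (m'⁻¹ + (u⁻¹ - v⁻¹)) - (v⁻¹ + (u⁻¹ - v⁻¹)) :=
        (ENNReal.add_sub_add_eq_sub_right (ENNReal.sub_ne_top hu')).symm
    _ = (m'⁻¹ + (u⁻¹ - v⁻¹)) - u⁻¹ := by rw [add_tsub_cancel_of_le (ENNReal.inv_le_inv.2 huv)]
    _ ≤ m⁻¹ - u⁻¹ := tsub_le_tsub_right h _

theorem inv_add_inv_le_right (s t : ℝ≥0∞) : (s + t⁻¹)⁻¹ ≤ t :=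
  ENNReal.inv_le_iff_inv_le.1 le_add_self

/-- `1 / (1 / t + Δ)` is the least error with which an unbiased measurement of variance `1 / Δ`,
given the weight `c`, can be combined with an estimate of variance `t`. -/
theorem inv_inv_add_eq_iInf (t : ℝ≥0∞) {Δ : ℝ} (hΔ : 0 < Δ) :
    (t⁻¹ + ENNReal.ofReal Δ)⁻¹ =
      ⨅ c : ℝ, (ENNReal.ofReal ((1 - c) ^ 2) * t + ENNReal.ofReal (c ^ 2 / Δ)) := by
  rcases eq_or_ne t ⊤ with rfl | ht
  · refine le_antisymm (le_iInf fun c => ?_) (iInf_le_of_le 1 ?_)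
    · rcases eq_or_ne c 1 with rfl | hc
      · simp [ENNReal.ofReal_inv_of_pos hΔ]
      · simp [ENNReal.mul_top, sub_ne_zero.2 hc.symm]
    · simp [ENNReal.ofReal_inv_of_pos hΔ]
  obtain ⟨t, ht0, rfl⟩ : ∃ s : ℝ, 0 ≤ s ∧ t = ENNReal.ofReal s :=
    ⟨t.toReal, ENNReal.toReal_nonneg, (ENNReal.ofReal_toReal ht).symm⟩
  have hpos : 0 < 1 + Δ * t := by positivity
  have hinv : ((ENNReal.ofReal t)⁻¹ + ENNReal.ofReal Δ)⁻¹ = ENNReal.ofReal (t / (1 + Δ * t)) := by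
    rcases ht0.eq_or_lt with rfl | ht0
    · simp
    · rw [← ENNReal.ofReal_inv_of_pos ht0, ← ENNReal.ofReal_add (by positivity) hΔ.le,
        ← ENNReal.ofReal_inv_of_pos (by positivity)]
      congr 1
      field_simp
  have hsquare (c : ℝ) : (1 - c) ^ 2 * t + c ^ 2 / Δ =
      t / (1 + Δ * t) + (c * (1 + Δ * t) - Δ * t) ^ 2 / (Δ * (1 + Δ * t)) := by
    field_simp
    ring
  have hterm (c : ℝ) : ENNReal.ofReal ((1 - c) ^ 2) * ENNReal.ofReal t +
      ENNReal.ofReal (c ^ 2 / Δ) = ENNReal.ofReal ((1 - c) ^ 2 * t + c ^ 2 / Δ) := by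
    rw [← ENNReal.ofReal_mul (sq_nonneg _), ← ENNReal.ofReal_add (by positivity) (by positivity)]
  simp only [hinv, hterm, hsquare]
  refine le_antisymm (le_iInf fun c => ENNReal.ofReal_le_ofReal ?_)
    (iInf_le_of_le (Δ * t / (1 + Δ * t)) (ENNReal.ofReal_le_ofReal ?_))
  · exact le_add_of_nonneg_right (by positivity)
  · rw [div_mul_cancel₀ _ hpos.ne']
    simp

/-- Jensen's inequality for the parallel sum with a constant, as an exchange of an infimum of
affine functions with the integral. -/
theorem lintegral_inv_inv_add_le {Ω : Type*} [MeasurableSpace Ω] {P : Measure Ω}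
    (hP : P univ ≤ 1) (T : Ω → ℝ≥0∞) {Δ : ℝ} (hΔ : 0 < Δ) :
    ∫⁻ x, ((T x)⁻¹ + ENNReal.ofReal Δ)⁻¹ ∂P ≤ ((∫⁻ x, T x ∂P)⁻¹ + ENNReal.ofReal Δ)⁻¹ := by
  rw [inv_inv_add_eq_iInf _ hΔ]
  refine le_iInf fun c => ?_
  calc ∫⁻ x, ((T x)⁻¹ + ENNReal.ofReal Δ)⁻¹ ∂P
      ≤ ∫⁻ x, (ENNReal.ofReal ((1 - c) ^ 2) * T x + ENNReal.ofReal (c ^ 2 / Δ)) ∂P :=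
        lintegral_mono fun x => (inv_inv_add_eq_iInf _ hΔ).trans_le (iInf_le _ c)
    _ = ENNReal.ofReal ((1 - c) ^ 2) * ∫⁻ x, T x ∂P + ENNReal.ofReal (c ^ 2 / Δ) * P univ := by
        rw [lintegral_add_right _ measurable_const, lintegral_const_mul' _ _ ENNReal.ofReal_ne_top,
          lintegral_const]
    _ ≤ _ := by
        gcongr
        exact mul_le_of_le_one_right' hP

/-! ### Gaussian integrals -/

/-- The standard Gaussian law on `ℝ`. -/
abbrev gauss : Measure ℝ := gaussianReal 0 1

theorem integrable_id_gauss : Integrable (fun w : ℝ => w) gauss :=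
  IsGaussian.integrable_id (μ := gauss)

theorem memLp_two_id_gauss : MemLp (fun w : ℝ => w) 2 gauss := IsGaussian.memLp_two_id

theorem integral_sq_gauss : ∫ w, w ^ 2 ∂gauss = 1 := by
  have h := variance_fun_id_gaussianReal (μ := 0) (v := 1)
  rw [variance_eq_integral (by fun_prop)] at h
  simpa using h

theorem lintegral_sub_mul_sq_gauss (x c : ℝ) :
    ∫⁻ w, ENNReal.ofReal ((x - c * w) ^ 2) ∂gauss = ENNReal.ofReal (x ^ 2 + c ^ 2) := by
  have hlin : Integrable (fun w : ℝ => x ^ 2 - 2 * x * c * w) gauss :=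
    (integrable_const _).sub (integrable_id_gauss.const_mul _)
  have hquad : Integrable (fun w : ℝ => c ^ 2 * w ^ 2) gauss :=
    memLp_two_id_gauss.integrable_sq.const_mul _
  have hexpand : (fun w : ℝ => (x - c * w) ^ 2) =
      (fun w => x ^ 2 - 2 * x * c * w) + fun w => c ^ 2 * w ^ 2 := by
    ext w
    simp only [Pi.add_apply]
    ring
  have hint : Integrable (fun w : ℝ => (x - c * w) ^ 2) gauss := hexpand ▸ hlin.add hquad
  rw [← ofReal_integral_eq_lintegral_ofReal hint (Eventually.of_forall fun w => sq_nonneg _),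
    hexpand, integral_add' hlin hquad,
    integral_sub (integrable_const _) (integrable_id_gauss.const_mul _), integral_const_mul,
    integral_const_mul, integral_sq_gauss, integral_id_gaussianReal]
  simp

theorem lintegral_sq_gauss : ∫⁻ w, ENNReal.ofReal (w ^ 2) ∂gauss = 1 := by
  simpa using lintegral_sub_mul_sq_gauss 0 1

theorem measurePreserving_reflection_gauss {a b : ℝ} (h : a ^ 2 + b ^ 2 = 1) :
    MeasurePreserving (fun p : ℝ × ℝ => (a * p.1 + b * p.2, b * p.1 - a * p.2))
      (gauss.prod gauss) (gauss.prod gauss) := by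
  obtain ⟨θ, rfl, rfl⟩ : ∃ θ : ℝ, Real.cos θ = a ∧ Real.sin θ = b := by
    have hnorm : ‖(⟨a, b⟩ : ℂ)‖ = 1 := by
      rw [Complex.norm_eq_sqrt_sq_add_sq]
      simp [h]
    have hne : (⟨a, b⟩ : ℂ) ≠ 0 := norm_ne_zero_iff.1 (hnorm ▸ one_ne_zero)
    exact ⟨Complex.arg ⟨a, b⟩, by rw [Complex.cos_arg hne, hnorm, div_one],
      by rw [Complex.sin_arg, hnorm, div_one]⟩
  have hrot : MeasurePreserving (ContinuousLinearMap.rotation θ : ℝ × ℝ → ℝ × ℝ)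
      (gauss.prod gauss) (gauss.prod gauss) :=
    ⟨(ContinuousLinearMap.continuous _).measurable, IsGaussian.map_rotation_eq_self (by simp) θ⟩
  have hneg : MeasurePreserving (fun x : ℝ => -x) gauss gauss :=
    ⟨measurable_neg, by simpa using gaussianReal_map_neg (μ := 0) (v := 1)⟩
  have hrefl := ((MeasurePreserving.id gauss).prod hneg).comp hrot
  convert hrefl using 1
  ext p
  · simp [ContinuousLinearMap.rotation_apply]
  · simp [ContinuousLinearMap.rotation_apply, sub_eq_neg_add]

theorem lintegral_reflection_gauss {Ω : Type*} [MeasurableSpace Ω] {μ : Measure Ω} [SFinite μ]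
    {a b : ℝ} (h : a ^ 2 + b ^ 2 = 1) {G : Ω × ℝ × ℝ → ℝ≥0∞} (hG : Measurable G) :
    ∫⁻ w, ∫⁻ z, ∫⁻ n, G (z, a * n + b * w, b * n - a * w) ∂gauss ∂μ ∂gauss =
      ∫⁻ z, ∫⁻ n, ∫⁻ w, G (z, n, w) ∂gauss ∂gauss ∂μ := by
  have hswap : Measurable fun q : (ℝ × Ω) × ℝ =>
      G (q.1.2, a * q.2 + b * q.1.1, b * q.2 - a * q.1.1) := hG.comp (by fun_prop)
  rw [lintegral_lintegral_swap hswap.lintegral_prod_right'.aemeasurable]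
  refine lintegral_congr fun z => ?_
  have hGz : Measurable fun q : ℝ × ℝ => G (z, q) := hG.comp (by fun_prop)
  have hrefl := measurePreserving_reflection_gauss h
  calc ∫⁻ w, ∫⁻ n, G (z, a * n + b * w, b * n - a * w) ∂gauss ∂gauss
      = ∫⁻ q, G (z, a * q.1 + b * q.2, b * q.1 - a * q.2) ∂(gauss.prod gauss) :=
        (lintegral_prod_symm' _ (hGz.comp hrefl.measurable)).symm
    _ = ∫⁻ q, G (z, q) ∂(gauss.prod gauss) := hrefl.lintegral_comp hGz
    _ = ∫⁻ n, ∫⁻ w, G (z, n, w) ∂gauss ∂gauss := lintegral_prod _ hGz.aemeasurable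

/-! ### The conditional mean squared error as a least risk -/

section CondExp

variable {Ω : Type*} {m m₀ : MeasurableSpace Ω} {μ : Measure[m₀] Ω} [IsFiniteMeasure μ]
  {X Y : Ω → ℝ}

theorem integral_mul_sub_condExp_eq_zero (hm : m ≤ m₀) (hX : MemLp X 2 μ)
    (hY : StronglyMeasurable[m] Y) (hY2 : MemLp Y 2 μ) :
    ∫ ω, Y ω * (X ω - (μ[X | m]) ω) ∂μ = 0 := by
  have hYX : Integrable (Y * X) μ := hY2.integrable_mul hX
  have hYE : Integrable (Y * μ[X | m]) μ := hY2.integrable_mul (hX.condExp (by norm_num))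
  have htower : ∫ ω, (Y * X) ω ∂μ = ∫ ω, (Y * μ[X | m]) ω ∂μ := by
    rw [← integral_condExp hm (f := Y * X)]
    exact integral_congr_ae
      (condExp_mul_of_stronglyMeasurable_left hY hYX (hX.integrable (by norm_num)))
  simp only [mul_sub]
  exact (integral_sub hYX hYE).trans (sub_eq_zero.2 htower)

theorem integral_sub_condExp_sq_le (hm : m ≤ m₀) (hX : MemLp X 2 μ)
    (hY : StronglyMeasurable[m] Y) (hY2 : MemLp Y 2 μ) :
    ∫ ω, (X ω - (μ[X | m]) ω) ^ 2 ∂μ ≤ ∫ ω, (X ω - Y ω) ^ 2 ∂μ := by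
  set E := μ[X | m]
  have hE2 : MemLp E 2 μ := hX.condExp (by norm_num)
  have hEY : MemLp (E - Y) 2 μ := hE2.sub hY2
  have horth : ∫ ω, (E - Y) ω * (X ω - E ω) ∂μ = 0 :=
    integral_mul_sub_condExp_eq_zero hm hX (stronglyMeasurable_condExp.sub hY) hEY
  have hcross : Integrable (fun ω => 2 * ((E - Y) ω * (X ω - E ω))) μ :=
    (hEY.integrable_mul (hX.sub hE2)).const_mul 2
  have hXE : Integrable (fun ω => (X ω - E ω) ^ 2) μ := (hX.sub hE2).integrable_sq
  have hEYsq : Integrable (fun ω => (E - Y) ω ^ 2) μ := hEY.integrable_sq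
  have hsum : Integrable (fun ω => (X ω - E ω) ^ 2 + (E - Y) ω ^ 2) μ := hXE.add hEYsq
  calc ∫ ω, (X ω - E ω) ^ 2 ∂μ
      ≤ ∫ ω, (X ω - E ω) ^ 2 ∂μ + ∫ ω, (E - Y) ω ^ 2 ∂μ :=
        le_add_of_nonneg_right (integral_nonneg fun ω => sq_nonneg _)
    _ = ∫ ω, ((X ω - E ω) ^ 2 + (E - Y) ω ^ 2 + 2 * ((E - Y) ω * (X ω - E ω))) ∂μ := by
        rw [integral_add hsum hcross, integral_add hXE hEYsq, integral_const_mul,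
          horth, mul_zero, add_zero]
    _ = ∫ ω, (X ω - Y ω) ^ 2 ∂μ := by
        refine integral_congr_ae (Eventually.of_forall fun ω => ?_)
        simp only [Pi.sub_apply]
        ring

end CondExp

section Risk

variable {Ω : Type*} [MeasurableSpace Ω] {μ : Measure Ω} {Z U : Ω → ℝ} {g : ℝ × ℝ → ℝ}

/-- Mean squared error of the estimator `g (√s Z + N, U)` of `Z`, with `N` the second coordinate
of `Ω × ℝ`, as in `condMMSE`. -/
def estRisk (μ : Measure Ω) (Z U : Ω → ℝ) (s : ℝ) (g : ℝ × ℝ → ℝ) : ℝ≥0∞ :=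
  ∫⁻ p : Ω × ℝ, ENNReal.ofReal ((Z p.1 - g (√s * Z p.1 + p.2, U p.1)) ^ 2) ∂(μ.prod gauss)

theorem measurable_comp_observation (hZ : Measurable Z) (hU : Measurable U) (hg : Measurable g)
    (s : ℝ) : Measurable fun p : Ω × ℝ => g (√s * Z p.1 + p.2, U p.1) :=
  hg.comp (by fun_prop)

theorem condMMSE_le_estRisk [IsFiniteMeasure μ] (hZ : Measurable Z) (hZ2 : MemLp Z 2 μ)
    (hU : Measurable U) (s : ℝ) (hg : Measurable g) :
    ENNReal.ofReal (condMMSE μ Z U s) ≤ estRisk μ Z U s g := by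
  by_cases htop : estRisk μ Z U s g = ⊤
  · exact htop ▸ le_top
  have hobs : Measurable fun p : Ω × ℝ => (√s * Z p.1 + p.2, U p.1) := by fun_prop
  have := measurable_comp_observation hZ hU hg s
  have hZ2' : MemLp (fun p : Ω × ℝ => Z p.1) 2 (μ.prod gauss) := hZ2.comp_fst gauss
  have herr : MemLp (fun p : Ω × ℝ => Z p.1 - g (√s * Z p.1 + p.2, U p.1)) 2 (μ.prod gauss) := by
    rw [memLp_two_iff_integrable_sq (by fun_prop)]
    refine ⟨by fun_prop, ?_⟩
    rw [hasFiniteIntegral_iff_ofReal (Eventually.of_forall fun p => sq_nonneg _)]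
    exact lt_top_iff_ne_top.2 htop
  have hg2 : MemLp (fun p : Ω × ℝ => g (√s * Z p.1 + p.2, U p.1)) 2 (μ.prod gauss) := by
    convert hZ2'.sub herr using 1
    ext p
    simp
  rw [estRisk, ← ofReal_integral_eq_lintegral_ofReal herr.integrable_sq
    (Eventually.of_forall fun p => sq_nonneg _)]
  exact ENNReal.ofReal_le_ofReal (integral_sub_condExp_sq_le hobs.comap_le hZ2'
    (hg.comp (comap_measurable _)).stronglyMeasurable hg2)

theorem exists_estRisk_eq_condMMSE [IsFiniteMeasure μ] (hZ2 : MemLp Z 2 μ) (U : Ω → ℝ) (s : ℝ) :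
    ∃ g, Measurable g ∧ estRisk μ Z U s g = ENNReal.ofReal (condMMSE μ Z U s) := by
  have hZ2' : MemLp (fun p : Ω × ℝ => Z p.1) 2 (μ.prod gauss) := hZ2.comp_fst gauss
  obtain ⟨g, hg, hgE⟩ := (stronglyMeasurable_condExp
    (m := MeasurableSpace.comap (fun p : Ω × ℝ => (√s * Z p.1 + p.2, U p.1)) inferInstance)
    (μ := μ.prod gauss) (f := fun p : Ω × ℝ => Z p.1)).measurable.exists_eq_measurable_comp
  refine ⟨g, hg, ?_⟩
  refine Eq.trans (lintegral_congr fun p => by rw [hgE]; rfl) (ofReal_integral_eq_lintegral_ofReal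
    (hZ2'.sub (hZ2'.condExp (by norm_num))).integrable_sq
    (Eventually.of_forall fun p => sq_nonneg _)).symm

/-- A measurement of signal-to-noise ratio `s + Δ` is split by means of the auxiliary noise `w`
into independent ones of ratios `s` and `Δ`; the first is fed to the estimator `g` and the second
is averaged in with the weight `c`. -/
def splitEstimator (s Δ c : ℝ) (g : ℝ × ℝ → ℝ) (w : ℝ) (y : ℝ × ℝ) : ℝ :=
  (1 - c) * g (√s / √(s + Δ) * y.1 + √Δ / √(s + Δ) * w, y.2) +
    c / √Δ * (√Δ / √(s + Δ) * y.1 - √s / √(s + Δ) * w)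

theorem measurable_splitEstimator (s Δ c : ℝ) (hg : Measurable g) (w : ℝ) :
    Measurable (splitEstimator s Δ c g w) := by
  have : Measurable fun y : ℝ × ℝ => g (√s / √(s + Δ) * y.1 + √Δ / √(s + Δ) * w, y.2) :=
    hg.comp (by fun_prop)
  unfold splitEstimator
  fun_prop

theorem sub_splitEstimator {s Δ : ℝ} (hs : 0 ≤ s) (hΔ : 0 < Δ) (c : ℝ) (g : ℝ × ℝ → ℝ)
    (w z n u : ℝ) :
    z - splitEstimator s Δ c g w (√(s + Δ) * z + n, u) =
      (1 - c) * (z - g (√s * z + (√s / √(s + Δ) * n + √Δ / √(s + Δ) * w), u)) -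
        c / √Δ * (√Δ / √(s + Δ) * n - √s / √(s + Δ) * w) := by
  have : 0 < √(s + Δ) := Real.sqrt_pos.2 (by linarith)
  have : 0 < √Δ := Real.sqrt_pos.2 hΔ
  have hfirst : √s / √(s + Δ) * (√(s + Δ) * z + n) + √Δ / √(s + Δ) * w =
      √s * z + (√s / √(s + Δ) * n + √Δ / √(s + Δ) * w) := by
    field_simp
    ring
  rw [splitEstimator, hfirst]
  field_simp
  ring

theorem lintegral_estRisk_splitEstimator [IsProbabilityMeasure μ] (hZ : Measurable Z)
    (hU : Measurable U) {s Δ : ℝ} (hs : 0 ≤ s) (hΔ : 0 < Δ) (c : ℝ) (hg : Measurable g) :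
    ∫⁻ w, estRisk μ Z U (s + Δ) (splitEstimator s Δ c g w) ∂gauss =
      ENNReal.ofReal ((1 - c) ^ 2) * estRisk μ Z U s g + ENNReal.ofReal (c ^ 2 / Δ) := by
  have hangle : (√s / √(s + Δ)) ^ 2 + (√Δ / √(s + Δ)) ^ 2 = 1 := by
    rw [div_pow, div_pow, Real.sq_sqrt hs, Real.sq_sqrt hΔ.le, Real.sq_sqrt (by linarith)]
    field_simp
  let G : Ω × ℝ × ℝ → ℝ≥0∞ := fun q => ENNReal.ofReal
    (((1 - c) * (Z q.1 - g (√s * Z q.1 + q.2.1, U q.1)) - c / √Δ * q.2.2) ^ 2)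
  have hG : Measurable G := by
    have : Measurable fun q : Ω × ℝ × ℝ => g (√s * Z q.1 + q.2.1, U q.1) := hg.comp (by fun_prop)
    fun_prop
  calc ∫⁻ w, estRisk μ Z U (s + Δ) (splitEstimator s Δ c g w) ∂gauss
      = ∫⁻ w, ∫⁻ z, ∫⁻ n, G (z, √s / √(s + Δ) * n + √Δ / √(s + Δ) * w,
          √Δ / √(s + Δ) * n - √s / √(s + Δ) * w) ∂gauss ∂μ ∂gauss := by
        refine lintegral_congr fun w => ?_
        have := measurable_comp_observation hZ hU (measurable_splitEstimator s Δ c hg w) (s + Δ)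
        rw [estRisk, lintegral_prod _ (by fun_prop)]
        simp only [sub_splitEstimator hs hΔ, G]
    _ = ∫⁻ z, ∫⁻ n, ∫⁻ w, G (z, n, w) ∂gauss ∂gauss ∂μ := lintegral_reflection_gauss hangle hG
    _ = ∫⁻ p : Ω × ℝ, (ENNReal.ofReal ((1 - c) ^ 2) *
          ENNReal.ofReal ((Z p.1 - g (√s * Z p.1 + p.2, U p.1)) ^ 2) +
            ENNReal.ofReal (c ^ 2 / Δ)) ∂(μ.prod gauss) := by
        rw [lintegral_prod _ (by fun_prop)]
        refine lintegral_congr fun z => lintegral_congr fun n => ?_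
        simp only [G]
        rw [lintegral_sub_mul_sq_gauss, mul_pow, div_pow, Real.sq_sqrt hΔ.le,
          ENNReal.ofReal_add (by positivity) (by positivity), ENNReal.ofReal_mul (sq_nonneg _)]
    _ = _ := by
        rw [lintegral_add_right _ measurable_const,
          lintegral_const_mul' _ _ ENNReal.ofReal_ne_top, lintegral_const, measure_univ, mul_one,
          estRisk]

theorem inv_condMMSE_add_le [IsProbabilityMeasure μ] (hZ : Measurable Z) (hZ2 : MemLp Z 2 μ)
    (hU : Measurable U) {s Δ : ℝ} (hs : 0 ≤ s) (hΔ : 0 < Δ) :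
    (ENNReal.ofReal (condMMSE μ Z U s))⁻¹ + ENNReal.ofReal Δ ≤
      (ENNReal.ofReal (condMMSE μ Z U (s + Δ)))⁻¹ := by
  obtain ⟨g, hg, hgs⟩ := exists_estRisk_eq_condMMSE hZ2 U s
  rw [← inv_inv (_ + _), ENNReal.inv_le_inv, inv_inv_add_eq_iInf _ hΔ, ← hgs]
  refine le_iInf fun c => ?_
  rw [← lintegral_estRisk_splitEstimator hZ hU hs hΔ c hg]
  calc ENNReal.ofReal (condMMSE μ Z U (s + Δ))
      = ∫⁻ _ : ℝ, ENNReal.ofReal (condMMSE μ Z U (s + Δ)) ∂gauss := by simp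
    _ ≤ _ := lintegral_mono fun w =>
        condMMSE_le_estRisk hZ hZ2 hU _ (measurable_splitEstimator s Δ c hg w)

end Risk

/-! ### Monotonicity of the state evolution maps -/

theorem phi_of_ne_zero (f : ℝ → ℝ) {v : ℝ≥0∞} (hv : v ≠ 0) :
    phi f v = extrinsic (mmseZ f v) v := if_neg hv

theorem inv_mmseZ_add_le {f : ℝ → ℝ} (hf : Measurable f) {u v : ℝ≥0∞} (hu : u ≠ 0) (huv : u ≤ v)
    (hv : v ≤ 1) : (mmseZ f v)⁻¹ + (u⁻¹ - v⁻¹) ≤ (mmseZ f u)⁻¹ := by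
  rcases huv.eq_or_lt with rfl | hlt
  · simp
  have hvt : v ≠ ⊤ := ne_top_of_le_ne_top ENNReal.one_ne_top hv
  have hu0 : 0 < u.toReal := ENNReal.toReal_pos hu hlt.ne_top
  have hlt' : u.toReal < v.toReal := ENNReal.toReal_strict_mono hvt hlt
  have hv0 : 0 < v.toReal := hu0.trans hlt'
  have hv1 : 1 ≤ v.toReal⁻¹ :=
    (one_le_inv₀ hv0).2 (by simpa using ENNReal.toReal_mono ENNReal.one_ne_top hv)
  have hgain : u⁻¹ - v⁻¹ = ENNReal.ofReal (u.toReal⁻¹ - v.toReal⁻¹) := by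
    rw [ENNReal.ofReal_sub _ (by positivity), ENNReal.ofReal_inv_of_pos hu0,
      ENNReal.ofReal_inv_of_pos hv0, ENNReal.ofReal_toReal hlt.ne_top, ENNReal.ofReal_toReal hvt]
  have h := inv_condMMSE_add_le (μ := gauss) measurable_id memLp_two_id_gauss hf
    (sub_nonneg.2 hv1) (sub_pos.2 (inv_strictAnti₀ hu0 hlt'))
  rwa [show v.toReal⁻¹ - 1 + (u.toReal⁻¹ - v.toReal⁻¹) = u.toReal⁻¹ - 1 by ring, ← hgain] at h

theorem phi_monotoneOn {f : ℝ → ℝ} (hf : Measurable f) : MonotoneOn (phi f) (Iic 1) := by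
  have hpos {u v : ℝ≥0∞} (hu : u ≠ 0) (huv : u ≤ v) (hv : v ≤ 1) : phi f u ≤ phi f v := by
    rw [phi_of_ne_zero _ hu, phi_of_ne_zero _ (ne_bot_of_le_ne_bot hu huv)]
    exact extrinsic_le_extrinsic hu huv (inv_mmseZ_add_le hf hu huv hv)
  intro u _ v hv huv
  rcases eq_or_ne u 0 with rfl | hu
  · rcases eq_or_ne v 0 with rfl | hv0
    · exact le_rfl
    · rw [phi, if_pos rfl]
      refine limsup_le_of_le (by isBoundedDefault) ?_
      filter_upwards [Ioo_mem_nhdsGT (pos_iff_ne_zero.2 hv0)] with w hw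
      exact (phi_of_ne_zero f hw.1.ne').symm.trans_le (hpos hw.1.ne' hw.2.le hv)
  · exact hpos hu huv hv

/-- Mean squared error of the linear estimator, the counterpart of `mmseZ` for the spectrum `P`. -/
def lmmse (P : Measure ℝ) (δ : ℝ) (v : ℝ≥0∞) : ℝ≥0∞ :=
  (ENNReal.ofReal δ)⁻¹ * ∫⁻ x, (v⁻¹ + (ENNReal.ofReal x)⁻¹)⁻¹ ∂P

theorem Phi_zero (P : Measure ℝ) (δ : ℝ) : Phi P δ 0 = 0 := if_pos rfl

theorem Phi_of_ne_zero (P : Measure ℝ) (δ : ℝ) {v : ℝ≥0∞} (hv : v ≠ 0) :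
    Phi P δ v = extrinsic (lmmse P δ v) v := if_neg hv

theorem Phi_top (P : Measure ℝ) (δ : ℝ) :
    Phi P δ ⊤ = (ENNReal.ofReal δ)⁻¹ * ∫⁻ x, ENNReal.ofReal x ∂P := by
  simp [Phi_of_ne_zero, extrinsic, lmmse]

theorem inv_lmmse_add_le {P : Measure ℝ} [IsProbabilityMeasure P] {δ : ℝ} (hδ : 1 ≤ δ)
    {u v : ℝ≥0∞} (hu : u ≠ 0) (huv : u ≤ v) :
    (lmmse P δ v)⁻¹ + (u⁻¹ - v⁻¹) ≤ (lmmse P δ u)⁻¹ := by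
  rcases huv.eq_or_lt with rfl | hlt
  · simp
  have hgain : 0 < u⁻¹ - v⁻¹ := tsub_pos_of_lt (ENNReal.inv_lt_inv.2 hlt)
  have hgain_top : u⁻¹ - v⁻¹ ≠ ⊤ := ENNReal.sub_ne_top (ENNReal.inv_ne_top.2 hu)
  have hmass : ((ENNReal.ofReal δ)⁻¹ • P) univ ≤ 1 := by simpa using hδ
  have h := lintegral_inv_inv_add_le hmass (fun x => (v⁻¹ + (ENNReal.ofReal x)⁻¹)⁻¹)
    (ENNReal.toReal_pos hgain.ne' hgain_top)
  have hu_eq : u⁻¹ = v⁻¹ + (u⁻¹ - v⁻¹) := (add_tsub_cancel_of_le (ENNReal.inv_le_inv.2 huv)).symm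
  simp only [ENNReal.ofReal_toReal hgain_top, inv_inv, lintegral_smul_measure, smul_eq_mul,
    add_right_comm _ _ (u⁻¹ - v⁻¹), ← hu_eq] at h
  exact ENNReal.le_inv_iff_le_inv.1 h

theorem Phi_monotone {P : Measure ℝ} [IsProbabilityMeasure P] {δ : ℝ} (hδ : 1 ≤ δ) :
    Monotone (Phi P δ) := by
  intro u v huv
  rcases eq_or_ne u 0 with rfl | hu
  · exact (Phi_zero P δ).trans_le zero_le
  rw [Phi_of_ne_zero _ _ hu, Phi_of_ne_zero _ _ (ne_bot_of_le_ne_bot hu huv)]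
  exact extrinsic_le_extrinsic hu huv (inv_lmmse_add_le hδ hu huv)

/-! ### Eigenvalue distributions -/

namespace IsEigenvalueLaw

variable {ν : Measure ℝ}

theorem exists_ae_mem_Icc (hν : IsEigenvalueLaw ν) :
    ∃ a b : ℝ, 0 < a ∧ ∀ᵐ x ∂ν, x ∈ Icc a b :=
  let ⟨_, a, b, ha, hab⟩ := hν
  ⟨a, b, ha, ae_iff.2 hab⟩

theorem ae_pos (hν : IsEigenvalueLaw ν) : ∀ᵐ x ∂ν, 0 < x :=
  let ⟨_, _, ha, hab⟩ := hν.exists_ae_mem_Icc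
  hab.mono fun _ hx => ha.trans_le hx.1

theorem integrable_id (hν : IsEigenvalueLaw ν) : Integrable (fun x => x) ν := by
  have := hν.1
  obtain ⟨a, b, ha, hab⟩ := hν.exists_ae_mem_Icc
  refine Integrable.of_bound (by fun_prop) b (hab.mono fun x hx => ?_)
  rw [Real.norm_of_nonneg (ha.le.trans hx.1)]
  exact hx.2

theorem integral_pos (hν : IsEigenvalueLaw ν) : 0 < ∫ x, x ∂ν := by
  have := hν.1
  obtain ⟨a, b, ha, hab⟩ := hν.exists_ae_mem_Icc
  calc 0 < a := ha
    _ = ∫ _, a ∂ν := by simp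
    _ ≤ ∫ x, x ∂ν := integral_mono_ae (integrable_const _) hν.integrable_id
        (hab.mono fun x hx => hx.1)

theorem lintegral_ofReal (hν : IsEigenvalueLaw ν) :
    ∫⁻ x, ENNReal.ofReal x ∂ν = ENNReal.ofReal (∫ x, x ∂ν) :=
  (ofReal_integral_eq_lintegral_ofReal hν.integrable_id (hν.ae_pos.mono fun _ hx => hx.le)).symm

protected theorem spectrumAt (hν : IsEigenvalueLaw ν) {δ : ℝ} (hδ : 0 < δ) :
    IsEigenvalueLaw (spectrumAt ν δ) := by
  have := hν.1
  obtain ⟨a, b, ha, hab⟩ := hν.exists_ae_mem_Icc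
  have hc : 0 < δ / ∫ y, y ∂ν := div_pos hδ hν.integral_pos
  have hm : Measurable (fun x : ℝ => δ / (∫ y, y ∂ν) * x) := by fun_prop
  refine ⟨Measure.isProbabilityMeasure_map hm.aemeasurable,
    δ / (∫ y, y ∂ν) * a, δ / (∫ y, y ∂ν) * b, by positivity, ?_⟩
  rw [GLMEP.spectrumAt, Measure.map_apply hm measurableSet_Icc.compl]
  refine measure_mono_null ?_ (ae_iff.1 hab)
  exact fun x hx hxab => hx
    ⟨mul_le_mul_of_nonneg_left hxab.1 hc.le, mul_le_mul_of_nonneg_left hxab.2 hc.le⟩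

theorem integral_spectrumAt (hν : IsEigenvalueLaw ν) (δ : ℝ) :
    ∫ x, x ∂(GLMEP.spectrumAt ν δ) = δ := by
  rw [GLMEP.spectrumAt, integral_map (by fun_prop) (by fun_prop), integral_const_mul,
    div_mul_cancel₀ _ hν.integral_pos.ne']

end IsEigenvalueLaw

theorem Phi_le_one {ν : Measure ℝ} (hν : IsEigenvalueLaw ν) {δ : ℝ} (hδ : 1 ≤ δ) (v : ℝ≥0∞) :
    Phi (spectrumAt ν δ) δ v ≤ 1 := by
  have hδ0 : 0 < δ := by linarith
  have hspec := hν.spectrumAt hδ0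
  have := hspec.1
  calc Phi (spectrumAt ν δ) δ v ≤ Phi (spectrumAt ν δ) δ ⊤ := Phi_monotone hδ le_top
    _ = 1 := by
      rw [Phi_top, hspec.lintegral_ofReal, hν.integral_spectrumAt,
        ENNReal.inv_mul_cancel (by simpa using hδ0) ENNReal.ofReal_ne_top]

theorem seVr_le_one (f : ℝ → ℝ) {ν : Measure ℝ} (hν : IsEigenvalueLaw ν) {δ : ℝ} (hδ : 1 ≤ δ) :
    ∀ t, seVr f ν δ t ≤ 1
  | 0 => le_rfl
  | _ + 1 => Phi_le_one hν hδ _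

theorem vrStar_le_one (f : ℝ → ℝ) {ν : Measure ℝ} (hν : IsEigenvalueLaw ν) {δ : ℝ}
    (hδ : 1 ≤ δ) : vrStar f ν δ ≤ 1 :=
  limsup_le_of_le (by isBoundedDefault) (Eventually.of_forall (seVr_le_one f hν hδ))

theorem mse_eq_zero_iff {P : Measure ℝ} [NeZero P] (hP : ∀ᵐ x ∂P, 0 < x) {v : ℝ≥0∞} :
    mse P v = 0 ↔ v = 0 := by
  rw [mse, lintegral_eq_zero_iff (by fun_prop)]
  constructor
  · intro h
    obtain ⟨x, hx⟩ := h.exists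
    by_contra hv
    simp [ENNReal.div_eq_top, hv] at hx
  · rintro rfl
    filter_upwards [hP] with x hx
    simp [ENNReal.div_zero (ENNReal.ofReal_pos.2 hx).ne']

theorem mseStar_eq_zero_iff (f : ℝ → ℝ) {ν : Measure ℝ} (hν : IsEigenvalueLaw ν) {δ : ℝ}
    (hδ : 0 < δ) : mseStar f ν δ = 0 ↔ phi f (vrStar f ν δ) = 0 := by
  have := (hν.spectrumAt hδ).1
  exact mse_eq_zero_iff (hν.spectrumAt hδ).ae_pos

/-! ### Quantile functions -/

/-- The uniform law on `(0, 1)`. -/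
abbrev unif : Measure ℝ := volume.restrict (Ioo 0 1)

section Quantile

variable {ν : Measure ℝ} {x y : ℝ}

theorem nonempty_setOf_cdf_le (ν : Measure ℝ) (hy : 0 < y) : {x | cdf ν x ≤ y}.Nonempty :=
  ((tendsto_cdf_atBot ν).eventually (eventually_le_nhds hy)).exists

theorem bddAbove_setOf_cdf_le (ν : Measure ℝ) (hy : y < 1) : BddAbove {x | cdf ν x ≤ y} := by
  obtain ⟨b, hb⟩ := ((tendsto_cdf_atTop ν).eventually (eventually_gt_nhds hy)).exists
  exact ⟨b, fun x hx => le_of_not_gt fun hbx => (hb.trans_le (monotone_cdf ν hbx.le)).not_ge hx⟩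

theorem quantile_monotoneOn (ν : Measure ℝ) : MonotoneOn (quantile ν) (Ioo 0 1) :=
  fun _ hy _ hz hyz => csSup_le_csSup (bddAbove_setOf_cdf_le ν hz.2)
    (nonempty_setOf_cdf_le ν hy.1) fun _ hx => le_trans hx hyz

theorem aemeasurable_quantile (ν : Measure ℝ) : AEMeasurable (quantile ν) unif :=
  aemeasurable_restrict_of_monotoneOn measurableSet_Ioo (quantile_monotoneOn ν)

theorem quantile_le_of_lt_cdf (hy : 0 < y) (h : y < cdf ν x) : quantile ν y ≤ x :=
  csSup_le (nonempty_setOf_cdf_le ν hy) fun _ hz =>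
    le_of_not_gt fun hxz => (h.trans_le (monotone_cdf ν hxz.le)).not_ge hz

theorem le_cdf_of_quantile_le (hy : y < 1) (h : quantile ν y ≤ x) : y ≤ cdf ν x := by
  have hright : Tendsto (cdf ν) (𝓝[>] x) (𝓝 (cdf ν x)) :=
    ((cdf ν).right_continuous x).mono Ioi_subset_Ici_self
  refine ge_of_tendsto hright (eventually_mem_nhdsWithin.mono fun z hz => ?_)
  by_contra! hlt
  exact (h.trans_lt hz).not_ge (le_csSup (bddAbove_setOf_cdf_le ν hy) hlt.le)

theorem quantile_nonneg [IsProbabilityMeasure ν] (h : ∀ᵐ x ∂ν, 0 ≤ x) (hy : y ∈ Ioo 0 1) :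
    0 ≤ quantile ν y := by
  refine le_of_forall_lt fun x hx => ?_
  obtain ⟨z, hxz, hz⟩ := exists_between hx
  refine hxz.trans_le (le_csSup (bddAbove_setOf_cdf_le ν hy.2) ?_)
  have hnull : ν (Iic z) = 0 :=
    measure_mono_null (fun u hu => not_le.2 (lt_of_le_of_lt hu hz)) (ae_iff.1 h)
  simp [cdf_eq_real, measureReal_def, hnull, hy.1.le]

theorem map_quantile (ν : Measure ℝ) [IsProbabilityMeasure ν] : unif.map (quantile ν) = ν := by
  have : IsFiniteMeasure (unif.map (quantile ν)) := by infer_instance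
  refine Measure.ext_of_Iic _ _ fun x => ?_
  have hcdf := cdf_le_one ν x
  rw [Measure.map_apply_of_aemeasurable (aemeasurable_quantile ν) measurableSet_Iic,
    Measure.restrict_apply' measurableSet_Ioo, ← ofReal_cdf]
  refine le_antisymm ?_ ?_
  · calc volume (quantile ν ⁻¹' Iic x ∩ Ioo 0 1) ≤ volume (Ioc 0 (cdf ν x)) :=
          measure_mono fun y hy => ⟨hy.2.1, le_cdf_of_quantile_le hy.2.2 hy.1⟩
      _ = ENNReal.ofReal (cdf ν x) := by simp
  · calc ENNReal.ofReal (cdf ν x) = volume (Ioo 0 (cdf ν x)) := by simp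
      _ ≤ volume (quantile ν ⁻¹' Iic x ∩ Ioo 0 1) := measure_mono fun y hy =>
          ⟨quantile_le_of_lt_cdf hy.1 hy.2, hy.1, hy.2.trans_le hcdf⟩

theorem integral_comp_quantile [IsProbabilityMeasure ν] {k : ℝ → ℝ} (hk : Measurable k) :
    ∫ y, k (quantile ν y) ∂unif = ∫ x, k x ∂ν := by
  rw [← integral_map (aemeasurable_quantile ν) hk.aestronglyMeasurable, map_quantile]

theorem integrable_quantile [IsProbabilityMeasure ν] (h : Integrable (fun x => x) ν) :
    Integrable (quantile ν) unif :=
  (integrable_map_measure (g := id) (by fun_prop) (aemeasurable_quantile ν)).1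
    ((map_quantile ν).symm ▸ h)

theorem intervalIntegral_quantile [IsProbabilityMeasure ν] (h : ∫ x, x ∂ν ≠ 0) (u : ℝ) :
    ∫ y in (0 : ℝ)..u, quantile ν y = (∫ x, x ∂ν) * lorenz ν u := by
  have hmean : ∫ y in (0 : ℝ)..1, quantile ν y = ∫ x, x ∂ν := by
    rw [intervalIntegral.integral_of_le zero_le_one, integral_Ioc_eq_integral_Ioo]
    exact integral_comp_quantile measurable_id
  rw [lorenz, hmean, mul_div_cancel₀ _ h]

end Quantile

/-! ### Majorization and the Lorenz order -/

theorem exists_superlevel_ae_eq_Ioo {g : ℝ → ℝ} (hg : AntitoneOn g (Ioo 0 1)) (t : ℝ) :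
    ∃ u ∈ Icc (0 : ℝ) 1, {y | t < g y} =ᵐ[unif] Ioo 0 u := by
  set T : Set ℝ := {y | y ∈ Ioo (0 : ℝ) 1 ∧ t < g y}
  have hbdd : BddAbove T := ⟨1, fun y hy => hy.1.2.le⟩
  refine ⟨sSup T, ⟨Real.sSup_nonneg fun y hy => hy.1.1.le,
    Real.sSup_le (fun y hy => hy.1.2.le) zero_le_one⟩, eventuallyEq_set.2 ?_⟩
  have hne : ∀ᵐ y ∂unif, y ≠ sSup T := ae_restrict_of_ae (by simp [ae_iff, measure_singleton])
  filter_upwards [hne, ae_restrict_mem measurableSet_Ioo] with y hyu hy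
  refine ⟨fun hty => ⟨hy.1, lt_of_le_of_ne (le_csSup hbdd ⟨hy, hty⟩) hyu⟩, fun hyT => ?_⟩
  have hT : T.Nonempty := by
    by_contra h
    rw [not_nonempty_iff_eq_empty.1 h, Real.sSup_empty, Ioo_self] at hyT
    exact hyT
  obtain ⟨z, hz, hyz⟩ := exists_lt_of_lt_csSup hT hyT.2
  exact hz.2.trans_le (hg hy hz.1 hyz.le)

theorem integral_indicator_Iio_unif {c : ℝ} (hc : c ∈ Icc (0 : ℝ) 1) (a : ℝ) :
    ∫ t, (Iio c).indicator (fun _ => a) t ∂unif = c * a := by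
  have hinter : Iio c ∩ Ioo 0 1 = Ioo 0 c := by
    ext t
    simp only [mem_inter_iff, mem_Iio, mem_Ioo]
    exact ⟨fun h => ⟨h.2.1, h.1⟩, fun h => ⟨h.2, h.1, h.2.trans_le hc.2⟩⟩
  rw [integral_indicator measurableSet_Iio, Measure.restrict_restrict measurableSet_Iio, hinter,
    setIntegral_const]
  simp [measureReal_def, hc.1]

/-- The weight is the average over `t` of the indicators of its superlevel sets, which are initial
segments of `(0, 1)`. -/
theorem integral_mul_nonpos_of_antitoneOn {g h : ℝ → ℝ} (hg : AntitoneOn g (Ioo 0 1))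
    (hg01 : ∀ y ∈ Ioo (0 : ℝ) 1, g y ∈ Icc (0 : ℝ) 1) (hh : Integrable h unif)
    (hI : ∀ u ∈ Icc (0 : ℝ) 1, ∫ y in (0 : ℝ)..u, h y ≤ 0) : ∫ y, g y * h y ∂unif ≤ 0 := by
  let S : Set (ℝ × ℝ) := {p | p.2 < g p.1}
  let H : ℝ → ℝ → ℝ := fun y t => S.indicator (fun p => h p.1) (y, t)
  have hS : NullMeasurableSet S (unif.prod unif) := nullMeasurableSet_lt
    measurable_snd.aemeasurable (aemeasurable_restrict_of_antitoneOn measurableSet_Ioo hg).comp_fst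
  have hH : Integrable (Function.uncurry H) (unif.prod unif) := (hh.comp_fst _).indicator₀ hS
  have hlayer : ∫ y, g y * h y ∂unif = ∫ y, ∫ t, H y t ∂unif ∂unif :=
    setIntegral_congr_fun measurableSet_Ioo fun y hy =>
      (integral_indicator_Iio_unif (hg01 y hy) (h y)).symm
  rw [hlayer, integral_integral_swap hH]
  refine integral_nonpos fun t => ?_
  obtain ⟨u, hu, hTu⟩ := exists_superlevel_ae_eq_Ioo hg t
  calc ∫ y, H y t ∂unif = ∫ y, (Ioo 0 u).indicator h y ∂unif :=
        integral_congr_ae (indicator_ae_eq_of_ae_eq_set hTu)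
    _ = ∫ y in (0 : ℝ)..u, h y := by
        rw [integral_indicator measurableSet_Ioo, Measure.restrict_restrict measurableSet_Ioo,
          inter_eq_self_of_subset_left (Ioo_subset_Ioo_right hu.2), ← integral_Ioc_eq_integral_Ioo,
          intervalIntegral.integral_of_le hu.1]
    _ ≤ 0 := hI u hu

theorem div_one_add_mul_le_tangent {w x y : ℝ} (hw : 0 ≤ w) (hx : 0 ≤ x) (hy : 0 ≤ y) :
    x / (1 + w * x) ≤ y / (1 + w * y) + 1 / (1 + w * y) ^ 2 * (x - y) := by
  have : 0 < 1 + w * x := by positivity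
  have : 0 < 1 + w * y := by positivity
  have hgap : y / (1 + w * y) + 1 / (1 + w * y) ^ 2 * (x - y) - x / (1 + w * x) =
      w * (x - y) ^ 2 / ((1 + w * y) ^ 2 * (1 + w * x)) := by
    field_simp
    ring
  exact sub_nonneg.1 (hgap ▸ by positivity)

theorem integrable_div_one_add_mul {Ω : Type*} [MeasurableSpace Ω] {μ : Measure Ω} {r : Ω → ℝ}
    (hr : Integrable r μ) (hr0 : ∀ᵐ y ∂μ, 0 ≤ r y) {w : ℝ} (hw : 0 ≤ w) :
    Integrable (fun y => r y / (1 + w * r y)) μ := by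
  have hrm := hr.aestronglyMeasurable.aemeasurable
  refine hr.mono (hrm.div (by fun_prop)).aestronglyMeasurable (hr0.mono fun y hy => ?_)
  rw [Real.norm_of_nonneg (by positivity), Real.norm_of_nonneg hy]
  exact div_le_self hy (le_add_of_nonneg_right (by positivity))

theorem integral_div_one_add_mul_le_of_majorize {r₁ r₂ : ℝ → ℝ} (hr₁ : Integrable r₁ unif)
    (hr₂ : Integrable r₂ unif) (h₁ : ∀ y ∈ Ioo (0 : ℝ) 1, 0 ≤ r₁ y)
    (h₂ : ∀ y ∈ Ioo (0 : ℝ) 1, 0 ≤ r₂ y) (hmono : MonotoneOn r₂ (Ioo 0 1))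
    (hI : ∀ u ∈ Icc (0 : ℝ) 1, ∫ y in (0 : ℝ)..u, (r₁ y - r₂ y) ≤ 0) {w : ℝ} (hw : 0 ≤ w) :
    ∫ y, r₁ y / (1 + w * r₁ y) ∂unif ≤ ∫ y, r₂ y / (1 + w * r₂ y) ∂unif := by
  let slope : ℝ → ℝ := fun y => 1 / (1 + w * r₂ y) ^ 2
  have hslope01 : ∀ y ∈ Ioo (0 : ℝ) 1, slope y ∈ Icc (0 : ℝ) 1 := by
    intro y hy
    have hwr : 0 ≤ w * r₂ y := mul_nonneg hw (h₂ y hy)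
    exact ⟨by positivity, div_le_one_of_le₀ (one_le_pow₀ (by linarith)) (by positivity)⟩
  have hslope : AntitoneOn slope (Ioo 0 1) := by
    intro y hy z hz hyz
    have hwr : 0 ≤ w * r₂ y := mul_nonneg hw (h₂ y hy)
    have := hmono hy hz hyz
    refine one_div_le_one_div_of_le (by positivity) ?_
    gcongr
  have hslope_int : Integrable (fun y => slope y * (r₁ y - r₂ y)) unif := by
    refine (hr₁.sub hr₂).bdd_mul (c := 1)
      (aemeasurable_restrict_of_antitoneOn measurableSet_Ioo hslope).aestronglyMeasurable ?_
    filter_upwards [ae_restrict_mem measurableSet_Ioo] with y hy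
    rw [Real.norm_of_nonneg (hslope01 y hy).1]
    exact (hslope01 y hy).2
  have hint₁ := integrable_div_one_add_mul hr₁ (ae_restrict_of_forall_mem measurableSet_Ioo h₁) hw
  have hint₂ := integrable_div_one_add_mul hr₂ (ae_restrict_of_forall_mem measurableSet_Ioo h₂) hw
  calc ∫ y, r₁ y / (1 + w * r₁ y) ∂unif
      ≤ ∫ y, (r₂ y / (1 + w * r₂ y) + slope y * (r₁ y - r₂ y)) ∂unif :=
        setIntegral_mono_on hint₁ (hint₂.add hslope_int) measurableSet_Ioo
          fun y hy => div_one_add_mul_le_tangent hw (h₁ y hy) (h₂ y hy)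
    _ = ∫ y, r₂ y / (1 + w * r₂ y) ∂unif + ∫ y, slope y * (r₁ y - r₂ y) ∂unif :=
        integral_add hint₂ hslope_int
    _ ≤ ∫ y, r₂ y / (1 + w * r₂ y) ∂unif :=
        add_le_of_nonpos_right (integral_mul_nonpos_of_antitoneOn hslope hslope01 (hr₁.sub hr₂) hI)

theorem integral_spectrumAt_comp {ν : Measure ℝ} [IsProbabilityMeasure ν] (δ : ℝ) {k : ℝ → ℝ}
    (hk : Measurable k) :
    ∫ x, k x ∂(spectrumAt ν δ) = ∫ y, k (δ / (∫ x, x ∂ν) * quantile ν y) ∂unif := by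
  have hk' : Measurable fun x => k (δ / (∫ x, x ∂ν) * x) := hk.comp (by fun_prop)
  rw [spectrumAt, integral_map (by fun_prop) hk.aestronglyMeasurable, integral_comp_quantile hk']

theorem intervalIntegral_mul_quantile {ν : Measure ℝ} [IsProbabilityMeasure ν]
    (h : ∫ x, x ∂ν ≠ 0) (δ u : ℝ) :
    ∫ y in (0 : ℝ)..u, δ / (∫ x, x ∂ν) * quantile ν y = δ * lorenz ν u := by
  rw [intervalIntegral.integral_const_mul, intervalIntegral_quantile h, ← mul_assoc,
    div_mul_cancel₀ _ h]

theorem integral_div_one_add_mul_le_of_spikier {ν₁ ν₂ : Measure ℝ} (h₁ : IsEigenvalueLaw ν₁)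
    (h₂ : IsEigenvalueLaw ν₂) (hs : Spikier ν₁ ν₂) {δ w : ℝ} (hδ : 0 ≤ δ) (hw : 0 ≤ w) :
    ∫ x, x / (1 + w * x) ∂(spectrumAt ν₁ δ) ≤ ∫ x, x / (1 + w * x) ∂(spectrumAt ν₂ δ) := by
  have := h₁.1
  have := h₂.1
  have hscale {ν : Measure ℝ} (hν : IsEigenvalueLaw ν) : 0 ≤ δ / ∫ x, x ∂ν :=
    div_nonneg hδ hν.integral_pos.le
  have hint {ν : Measure ℝ} (hν : IsEigenvalueLaw ν) :
      Integrable (fun y => δ / (∫ x, x ∂ν) * quantile ν y) unif :=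
    have := hν.1
    (integrable_quantile hν.integrable_id).const_mul _
  have hnonneg {ν : Measure ℝ} (hν : IsEigenvalueLaw ν) (y : ℝ) (hy : y ∈ Ioo (0 : ℝ) 1) :
      0 ≤ δ / (∫ x, x ∂ν) * quantile ν y :=
    have := hν.1
    mul_nonneg (hscale hν) (quantile_nonneg (hν.ae_pos.mono fun _ hx => hx.le) hy)
  rw [integral_spectrumAt_comp δ (by fun_prop), integral_spectrumAt_comp δ (by fun_prop)]
  refine integral_div_one_add_mul_le_of_majorize (hint h₁) (hint h₂) (hnonneg h₁) (hnonneg h₂)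
    (fun y hy z hz hyz => mul_le_mul_of_nonneg_left (quantile_monotoneOn ν₂ hy hz hyz) (hscale h₂))
    (fun u hu => ?_) hw
  have hii {ν : Measure ℝ} (hν : IsEigenvalueLaw ν) :
      IntervalIntegrable (fun y => δ / (∫ x, x ∂ν) * quantile ν y) volume 0 u :=
    (intervalIntegrable_iff_integrableOn_Ioo_of_le hu.1).2
      (IntegrableOn.mono_set (hint hν) (Ioo_subset_Ioo_right hu.2))
  rw [intervalIntegral.integral_sub (hii h₁) (hii h₂),
    intervalIntegral_mul_quantile h₁.integral_pos.ne',
    intervalIntegral_mul_quantile h₂.integral_pos.ne', ← mul_sub]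
  exact mul_nonpos_of_nonneg_of_nonpos hδ (sub_nonpos.2 (hs u hu))

theorem lintegral_inv_add_inv_eq {P : Measure ℝ} (hP : ∀ᵐ x ∂P, 0 < x)
    (hint : Integrable (fun x => x) P) {w : ℝ} (hw : 0 ≤ w) :
    ∫⁻ x, (ENNReal.ofReal w + (ENNReal.ofReal x)⁻¹)⁻¹ ∂P =
      ENNReal.ofReal (∫ x, x / (1 + w * x) ∂P) := by
  have hP0 : ∀ᵐ x ∂P, 0 ≤ x := hP.mono fun _ hx => hx.le
  rw [ofReal_integral_eq_lintegral_ofReal (integrable_div_one_add_mul hint hP0 hw)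
    (hP0.mono fun x hx => by positivity)]
  refine lintegral_congr_ae (hP.mono fun x hx => ?_)
  dsimp only
  rw [← ENNReal.ofReal_inv_of_pos hx, ← ENNReal.ofReal_add hw (by positivity),
    ← ENNReal.ofReal_inv_of_pos (by positivity)]
  congr 1
  field_simp
  ring

theorem Phi_le_of_spikier {ν₁ ν₂ : Measure ℝ} (h₁ : IsEigenvalueLaw ν₁)
    (h₂ : IsEigenvalueLaw ν₂) (hs : Spikier ν₁ ν₂) {δ : ℝ} (hδ : 0 < δ) (v : ℝ≥0∞) :
    Phi (spectrumAt ν₁ δ) δ v ≤ Phi (spectrumAt ν₂ δ) δ v := by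
  rcases eq_or_ne v 0 with rfl | hv
  · simp only [Phi_zero, le_refl]
  rw [Phi_of_ne_zero _ _ hv, Phi_of_ne_zero _ _ hv]
  refine extrinsic_mono_left v (mul_le_mul_right ?_ _)
  have hlintegral {ν : Measure ℝ} (hν : IsEigenvalueLaw ν) :=
    lintegral_inv_add_inv_eq (hν.spectrumAt hδ).ae_pos (hν.spectrumAt hδ).integrable_id
      (ENNReal.toReal_nonneg (a := v⁻¹))
  rw [← ENNReal.ofReal_toReal (ENNReal.inv_ne_top.2 hv), hlintegral h₁, hlintegral h₂]
  exact ENNReal.ofReal_le_ofReal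
    (integral_div_one_add_mul_le_of_spikier h₁ h₂ hs hδ.le ENNReal.toReal_nonneg)

theorem seVr_le_of_spikier {f : ℝ → ℝ} (hf : Measurable f) {ν₁ ν₂ : Measure ℝ}
    (h₁ : IsEigenvalueLaw ν₁) (h₂ : IsEigenvalueLaw ν₂) (hs : Spikier ν₁ ν₂) {δ : ℝ}
    (hδ : 1 ≤ δ) (t : ℕ) : seVr f ν₁ δ t ≤ seVr f ν₂ δ t := by
  have hδ0 : 0 < δ := by linarith
  have := (h₁.spectrumAt hδ0).1
  induction t with
  | zero => exact le_rfl
  | succ t ih =>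
    calc seVr f ν₁ δ (t + 1) ≤ Phi (spectrumAt ν₁ δ) δ (phi f (seVr f ν₂ δ t)) :=
          Phi_monotone hδ (phi_monotoneOn hf (seVr_le_one f h₁ hδ t) (seVr_le_one f h₂ hδ t) ih)
      _ ≤ seVr f ν₂ δ (t + 1) := Phi_le_of_spikier h₁ h₂ hs hδ0 _

theorem threshold_le_of_spikier {f : ℝ → ℝ} (hf : Measurable f) {ν₁ ν₂ : Measure ℝ}
    (h₁ : IsEigenvalueLaw ν₁) (h₂ : IsEigenvalueLaw ν₂) (hs : Spikier ν₁ ν₂) :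
    threshold f ν₁ ≤ threshold f ν₂ := by
  refine sInf_le_sInf (image_mono ?_)
  rintro δ ⟨hδ, h0⟩
  refine ⟨hδ, ?_⟩
  rw [mseStar_eq_zero_iff f h₂ (by linarith)] at h0
  rw [mseStar_eq_zero_iff f h₁ (by linarith), ← nonpos_iff_eq_zero, ← h0]
  exact phi_monotoneOn hf (vrStar_le_one f h₁ hδ.le) (vrStar_le_one f h₂ hδ.le)
    (limsup_le_limsup (Eventually.of_forall (seVr_le_of_spikier hf h₁ h₂ hs hδ.le)))

/-! ### The risk at high signal-to-noise ratio -/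

section NormRisk

variable {f : ℝ → ℝ} {v : ℝ} {g : ℝ × ℝ → ℝ}

/-- Risk `𝔼 (W - g (A, f Z))²` in estimating the noise `W = √v Z - √(1-v) N` from `f Z` and
`A = √(1-v) Z + √v N`. Up to the factor `v` this is the risk in estimating `Z` from `f Z` and
`√(v⁻¹-1) Z + N = A / √v`. It is expressed in the independent standard Gaussian variables `A`
and `W`, so that `Z = √(1-v) A + √v W`. -/
def normRisk (f : ℝ → ℝ) (v : ℝ) (g : ℝ × ℝ → ℝ) : ℝ≥0∞ :=
  ∫⁻ p : ℝ × ℝ, ENNReal.ofReal ((p.2 - g (p.1, f (√(1 - v) * p.1 + √v * p.2))) ^ 2)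
    ∂(gauss.prod gauss)

/-- The estimator of `Z` from `√(v⁻¹-1) Z + N` and `f Z` that corresponds to the estimator `g` in
`normRisk`. -/
def denorm (v : ℝ) (g : ℝ × ℝ → ℝ) (y : ℝ × ℝ) : ℝ :=
  √v * (√(1 - v) * y.1 + g (√v * y.1, y.2))

theorem measurable_denorm (v : ℝ) (hg : Measurable g) : Measurable (denorm v g) := by
  have : Measurable fun y : ℝ × ℝ => g (√v * y.1, y.2) := hg.comp (by fun_prop)
  unfold denorm
  fun_prop

theorem measurable_normRisk_integrand (hf : Measurable f) (v : ℝ) (hg : Measurable g) :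
    Measurable fun p : ℝ × ℝ =>
      ENNReal.ofReal ((p.2 - g (p.1, f (√(1 - v) * p.1 + √v * p.2))) ^ 2) := by
  have : Measurable fun p : ℝ × ℝ => g (p.1, f (√(1 - v) * p.1 + √v * p.2)) :=
    hg.comp (by fun_prop)
  fun_prop

theorem estRisk_denorm (hf : Measurable f) (hv : 0 < v) (hv1 : v ≤ 1) (hg : Measurable g) :
    estRisk gauss id f (v⁻¹ - 1) (denorm v g) = ENNReal.ofReal v * normRisk f v g := by
  have hβ : 0 < √v := Real.sqrt_pos.2 hv
  have hα_sq : √(1 - v) ^ 2 = 1 - v := Real.sq_sqrt (by linarith)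
  have hβ_sq : √v ^ 2 = v := Real.sq_sqrt hv.le
  have hs : √(v⁻¹ - 1) = √(1 - v) / √v := by
    rw [← Real.sqrt_div (by linarith)]
    congr 1
    field_simp
  have hG := measurable_comp_observation (Z := id) measurable_id hf
    (measurable_denorm v hg) (v⁻¹ - 1)
  rw [estRisk, ← (measurePreserving_reflection_gauss (a := √(1 - v)) (b := √v)
    (by rw [hα_sq, hβ_sq]; ring)).lintegral_comp (by fun_prop), normRisk,
    ← lintegral_const_mul _ (measurable_normRisk_integrand hf v hg)]
  refine lintegral_congr fun p => ?_
  have hobs : √(v⁻¹ - 1) * (√(1 - v) * p.1 + √v * p.2) + (√v * p.1 - √(1 - v) * p.2) =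
      p.1 / √v := by
    rw [hs]
    field_simp
    linear_combination p.1 * hα_sq + p.1 * hβ_sq
  simp only [id, hobs, denorm, mul_div_cancel₀ _ hβ.ne']
  rw [← ENNReal.ofReal_mul hv.le]
  congr 1
  have hcancel : √v * (√(1 - v) * (p.1 / √v)) = √(1 - v) * p.1 := by field_simp
  rw [mul_add, hcancel]
  linear_combination (p.2 - g (p.1, f (√(1 - v) * p.1 + √v * p.2))) ^ 2 * hβ_sq

theorem mmseZ_ofReal (f : ℝ → ℝ) (hv : 0 ≤ v) :
    mmseZ f (ENNReal.ofReal v) = ENNReal.ofReal (condMMSE gauss id f (v⁻¹ - 1)) := by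
  rw [mmseZ, ENNReal.toReal_ofReal hv]

theorem mmseZ_le_mul_normRisk (hf : Measurable f) (hv : 0 < v) (hv1 : v ≤ 1) (hg : Measurable g) :
    mmseZ f (ENNReal.ofReal v) ≤ ENNReal.ofReal v * normRisk f v g := by
  rw [mmseZ_ofReal f hv.le, ← estRisk_denorm hf hv hv1 hg]
  exact condMMSE_le_estRisk measurable_id memLp_two_id_gauss hf _ (measurable_denorm v hg)

theorem exists_mul_normRisk_eq_mmseZ (hf : Measurable f) (hv : 0 < v) (hv1 : v ≤ 1) :
    ∃ g, Measurable g ∧ ENNReal.ofReal v * normRisk f v g = mmseZ f (ENNReal.ofReal v) := by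
  have hβ : √v ≠ 0 := (Real.sqrt_pos.2 hv).ne'
  obtain ⟨G, hG, hGe⟩ := exists_estRisk_eq_condMMSE memLp_two_id_gauss f (v⁻¹ - 1)
  have : Measurable fun y : ℝ × ℝ => G (y.1 / √v, y.2) := hG.comp (by fun_prop)
  set g : ℝ × ℝ → ℝ := fun y => G (y.1 / √v, y.2) / √v - √(1 - v) * (y.1 / √v) with hg_def
  have hg : Measurable g := by fun_prop
  have hdenorm : denorm v g = G := by
    funext y
    rw [denorm, hg_def]
    field_simp
    ring
  exact ⟨g, hg, by rw [← estRisk_denorm hf hv hv1 hg, hdenorm, mmseZ_ofReal f hv.le]; exact hGe⟩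

end NormRisk

/-! ### Flat sections -/

/-- The points at which `f` is locally constant, that is, the interior of its flat sections. -/
def flatSet (f : ℝ → ℝ) : Set ℝ := {x | ∀ᶠ y in 𝓝 x, f y = f x}

section FlatSet

variable {f : ℝ → ℝ}

theorem isOpen_flatSet (f : ℝ → ℝ) : IsOpen (flatSet f) := by
  refine isOpen_iff_mem_nhds.2 fun x hx => ?_
  rw [flatSet, mem_ofPred_eq] at hx
  filter_upwards [hx.eventually_nhds, hx] with y hy hyx
  filter_upwards [hy] with z hz
  rw [hz, hyx]

theorem measurableSet_flatSet (f : ℝ → ℝ) : MeasurableSet (flatSet f) :=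
  (isOpen_flatSet f).measurableSet

theorem subset_flatSet_of_const {U : Set ℝ} (hU : IsOpen U) {c : ℝ} (hc : ∀ x ∈ U, f x = c) :
    U ⊆ flatSet f := fun x hx => by
  filter_upwards [hU.mem_nhds hx] with y hy
  rw [hc y hy, hc x hx]

theorem notMem_flatSet_of_injOn {U : Set ℝ} (hU : IsOpen U) (hi : InjOn f U) {x : ℝ}
    (hx : x ∈ U) : x ∉ flatSet f := fun h => by
  have hconst : ∀ᶠ y in 𝓝 x, y = x := by
    filter_upwards [h, hU.mem_nhds hx] with y hy hyU using hi hyU hx hy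
  obtain ⟨y, hy, hyx⟩ := ((hconst.filter_mono nhdsWithin_le_nhds).and
    (self_mem_nhdsWithin (s := {x}ᶜ))).exists
  exact hyx hy

namespace PiecewiseSmooth

theorem measurable (hf : PiecewiseSmooth f) : Measurable f := by
  obtain ⟨K, I, hI, -, hU, hC⟩ := hf
  intro s hs
  rw [← univ_inter (f ⁻¹' s), ← hU, iUnion_inter]
  refine MeasurableSet.iUnion fun k => ?_
  have hrestrict : Measurable ((I k).domRestrict f) := (hC k).1.continuousOn.domRestrict.measurable
  convert (hI k).measurableSet.subtype_image (hrestrict hs) using 1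
  ext x
  simp [and_comm]

theorem exists_open_pieces (hf : PiecewiseSmooth f) :
    ∃ (K : ℕ) (U : Fin K → Set ℝ), (∀ k, IsOpen (U k)) ∧
      Pairwise (fun j k => Disjoint (U j) (U k)) ∧ (∀ᵐ x : ℝ, ∃ k, x ∈ U k) ∧
      ∀ k, DifferentiableOn ℝ f (U k) ∧ (InjOn f (U k) ∨ ∃ c, ∀ x ∈ U k, f x = c) := by
  obtain ⟨K, I, hI, hd, hU, hC⟩ := hf
  refine ⟨K, fun k => interior (I k), fun k => isOpen_interior, fun j k hjk =>
    (hd hjk).mono interior_subset interior_subset, ?_, fun k => ⟨?_, ?_⟩⟩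
  · have hfrontier : ∀ᵐ x : ℝ, ∀ k, x ∉ frontier (I k) := ae_all_iff.2 fun k =>
      measure_eq_zero_iff_ae_notMem.1 ((hI k).convex.addHaar_frontier volume)
    filter_upwards [hfrontier] with x hx
    obtain ⟨k, hk⟩ := mem_iUnion.1 (hU ▸ mem_univ x : x ∈ ⋃ k, I k)
    exact ⟨k, by_contra fun h => hx k ⟨subset_closure hk, h⟩⟩
  · exact ((hC k).1.differentiableOn (by norm_num)).mono interior_subset
  · rcases (hC k).2 with h | h | ⟨c, h⟩
    · exact Or.inl (h.injOn.mono interior_subset)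
    · exact Or.inl (h.injOn.mono interior_subset)
    · exact Or.inr ⟨c, fun x hx => h x (interior_subset hx)⟩

end PiecewiseSmooth

theorem exists_measurable_leftInvOn (hf : Measurable f) {U : Set ℝ} (hU : MeasurableSet U)
    (hi : InjOn f U) : ∃ h : ℝ → ℝ, Measurable h ∧ LeftInvOn h f U := by
  have := hU.standardBorel
  have hrestrict : Measurable (U.domRestrict f) := hf.comp measurable_subtype_coe
  obtain ⟨h, hh, hext⟩ := (hrestrict.measurableEmbedding hi.injective).exists_measurable_extend
    (g := fun x : U => (x : ℝ)) measurable_subtype_coe fun _ => inferInstance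
  exact ⟨h, hh, fun x hx => congrFun hext ⟨x, hx⟩⟩

/-- A rough location `a` of `x` singles out the piece on which `f` has to be inverted. -/
theorem PiecewiseSmooth.exists_local_inverse (hf : PiecewiseSmooth f) :
    ∃ H : ℝ × ℝ → ℝ, Measurable H ∧
      ∀ᵐ a : ℝ, a ∉ flatSet f → ∀ᶠ x in 𝓝 a, H (a, f x) = x := by
  classical
  obtain ⟨K, U, hU, hd, hae, hk⟩ := hf.exists_open_pieces
  have hinv : ∀ k, ∃ h : ℝ → ℝ, Measurable h ∧ (InjOn f (U k) → LeftInvOn h f (U k)) := by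
    intro k
    by_cases hi : InjOn f (U k)
    · obtain ⟨h, hh, hleft⟩ := exists_measurable_leftInvOn hf.measurable (hU k).measurableSet hi
      exact ⟨h, hh, fun _ => hleft⟩
    · exact ⟨fun _ => 0, measurable_const, fun h => absurd h hi⟩
  choose h hh hleft using hinv
  refine ⟨fun p => ∑ k, (Prod.fst ⁻¹' U k).indicator (fun p => h k p.2) p, ?_, ?_⟩
  · exact Finset.measurable_fun_sum _ fun k _ =>
      ((hh k).comp measurable_snd).indicator (measurable_fst (hU k).measurableSet)
  · filter_upwards [hae] with a ⟨k, hak⟩ haF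
    rcases (hk k).2 with hi | ⟨c, hc⟩
    · filter_upwards [(hU k).mem_nhds hak] with x hx
      rw [Finset.sum_eq_single k]
      · exact (indicator_of_mem (show (a, f x) ∈ Prod.fst ⁻¹' U k from hak) _).trans (hleft k hi hx)
      · exact fun j _ hjk => indicator_of_notMem
          (show (a, f x) ∉ Prod.fst ⁻¹' U j from disjoint_right.1 (hd hjk) hak) _
      · simp
    · exact absurd (subset_flatSet_of_const (hU k) hc hak) haF

end FlatSet

/-! ### The limit of the normalized error -/

/-- The law with density `w²` relative to the standard Gaussian law: the mass of a set is the error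
made by estimating the noise by `0` there. -/
def gaussSq : Measure ℝ := gauss.withDensity fun w => ENNReal.ofReal (w ^ 2)

theorem gaussSq_apply {s : Set ℝ} (hs : MeasurableSet s) :
    gaussSq s = ∫⁻ w in s, ENNReal.ofReal (w ^ 2) ∂gauss := withDensity_apply _ hs

instance : IsProbabilityMeasure gaussSq :=
  ⟨by rw [gaussSq_apply MeasurableSet.univ, Measure.restrict_univ, lintegral_sq_gauss]⟩

theorem tendsto_measure_ball_nat {E : Type*} [PseudoMetricSpace E] [MeasurableSpace E]
    (μ : Measure E) (x : E) : Tendsto (fun n : ℕ => μ (Metric.ball x n)) atTop (𝓝 (μ univ)) := by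
  rw [← Metric.iUnion_ball_nat x]
  exact tendsto_measure_iUnion_atTop fun m n hmn => Metric.ball_subset_ball (by exact_mod_cast hmn)

/-- Symmetrization in `w ↦ -w`: knowing that `w ∈ S` does not help to estimate `w`. -/
theorem gaussSq_le_setLIntegral_sub_sq {S : Set ℝ} (hS : MeasurableSet S) (hneg : -S = S) (c : ℝ) :
    gaussSq S ≤ ∫⁻ w in S, ENNReal.ofReal ((w - c) ^ 2) ∂gauss := by
  have hmp : MeasurePreserving (fun w : ℝ => -w) gauss gauss :=
    ⟨measurable_neg, by rw [gaussianReal_map_neg, neg_zero]⟩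
  have hsymm : ∫⁻ w in S, ENNReal.ofReal ((w + c) ^ 2) ∂gauss =
      ∫⁻ w in S, ENNReal.ofReal ((w - c) ^ 2) ∂gauss := by
    rw [← hmp.setLIntegral_comp_preimage hS (by fun_prop)]
    have hpre : (fun w : ℝ => -w) ⁻¹' S = S := hneg
    rw [hpre]
    refine lintegral_congr fun w => ?_
    congr 1
    ring
  refine (ENNReal.mul_le_mul_iff_right two_ne_zero ENNReal.ofNat_ne_top).1 ?_
  calc 2 * gaussSq S = ∫⁻ w in S, ENNReal.ofReal (2 * w ^ 2) ∂gauss := by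
        simp_rw [ENNReal.ofReal_mul zero_le_two, ENNReal.ofReal_ofNat]
        rw [lintegral_const_mul _ (by fun_prop), gaussSq_apply hS]
    _ ≤ ∫⁻ w in S, (ENNReal.ofReal ((w + c) ^ 2) + ENNReal.ofReal ((w - c) ^ 2)) ∂gauss := by
        refine lintegral_mono fun w => ?_
        rw [← ENNReal.ofReal_add (sq_nonneg _) (sq_nonneg _)]
        exact ENNReal.ofReal_le_ofReal (by nlinarith [sq_nonneg c])
    _ = 2 * ∫⁻ w in S, ENNReal.ofReal ((w - c) ^ 2) ∂gauss := by
        rw [lintegral_add_left (by fun_prop), hsymm, two_mul]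

section Limit

variable {f : ℝ → ℝ} {v : ℕ → ℝ}

/-- Near a point where `f` is constant, `f Z` carries no information about the noise. -/
theorem one_le_liminf_of_mem_flatSet {a : ℝ} (ha : a ∈ flatSet f) (hv : Tendsto v atTop (𝓝 0))
    (g : ℕ → ℝ × ℝ → ℝ) :
    1 ≤ liminf (fun n => ∫⁻ w, ENNReal.ofReal
      ((w - g n (a, f (√(1 - v n) * a + √(v n) * w))) ^ 2) ∂gauss) atTop := by
  obtain ⟨r, hr, hball⟩ := Metric.eventually_nhds_iff.1 ha
  rw [← measure_univ (μ := gaussSq)]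
  refine le_of_tendsto' (tendsto_measure_ball_nat gaussSq 0) fun m => ?_
  refine le_liminf_of_le (by isBoundedDefault) ?_
  have hbound : Tendsto (fun n => |√(1 - v n) * a - a| + √(v n) * m) atTop (𝓝 0) := by
    have hcont : Continuous fun u : ℝ => |√(1 - u) * a - a| + √u * m := by fun_prop
    simpa [Function.comp_def] using (hcont.tendsto 0).comp hv
  filter_upwards [hbound.eventually_lt_const hr] with n hn
  have hflat : ∀ w ∈ Metric.ball (0 : ℝ) m, f (√(1 - v n) * a + √(v n) * w) = f a := by
    intro w hw
    refine hball (lt_of_le_of_lt ?_ hn)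
    calc dist (√(1 - v n) * a + √(v n) * w) a
        = |(√(1 - v n) * a - a) + √(v n) * w| := by rw [Real.dist_eq]; ring_nf
      _ ≤ |√(1 - v n) * a - a| + √(v n) * |w| := by
        rw [← abs_of_nonneg (Real.sqrt_nonneg (v n)), ← abs_mul, abs_of_nonneg (Real.sqrt_nonneg _)]
        exact abs_add_le _ _
      _ ≤ _ := by gcongr; exact (mem_ball_zero_iff.1 hw).le
  calc gaussSq (Metric.ball 0 m)
      ≤ ∫⁻ w in Metric.ball 0 m, ENNReal.ofReal ((w - g n (a, f a)) ^ 2) ∂gauss :=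
        gaussSq_le_setLIntegral_sub_sq Metric.isOpen_ball.measurableSet (by simp) _
    _ = ∫⁻ w in Metric.ball 0 m, ENNReal.ofReal
          ((w - g n (a, f (√(1 - v n) * a + √(v n) * w))) ^ 2) ∂gauss :=
        setLIntegral_congr_fun Metric.isOpen_ball.measurableSet fun w hw => by
          simp only [hflat w hw]
    _ ≤ _ := setLIntegral_le_lintegral _ _

theorem le_liminf_normRisk (hf : Measurable f) (hv : Tendsto v atTop (𝓝 0))
    {g : ℕ → ℝ × ℝ → ℝ} (hg : ∀ n, Measurable (g n)) :
    gauss (flatSet f) ≤ liminf (fun n => normRisk f (v n) (g n)) atTop := by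
  have hm n := measurable_normRisk_integrand hf (v n) (hg n)
  calc gauss (flatSet f)
      = ∫⁻ a, (flatSet f).indicator 1 a ∂gauss :=
        (lintegral_indicator_one (measurableSet_flatSet f)).symm
    _ ≤ ∫⁻ a, liminf (fun n => ∫⁻ w, ENNReal.ofReal
          ((w - g n (a, f (√(1 - v n) * a + √(v n) * w))) ^ 2) ∂gauss) atTop ∂gauss := by
        refine lintegral_mono fun a => ?_
        by_cases ha : a ∈ flatSet f
        · simpa only [indicator_of_mem ha, Pi.one_apply] using one_le_liminf_of_mem_flatSet ha hv g
        · simp [ha]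
    _ ≤ liminf (fun n => ∫⁻ a, ∫⁻ w, ENNReal.ofReal
          ((w - g n (a, f (√(1 - v n) * a + √(v n) * w))) ^ 2) ∂gauss ∂gauss) atTop :=
        lintegral_liminf_le fun n => (hm n).lintegral_prod_right'
    _ = _ := by simp only [normRisk, lintegral_prod _ (hm _).aemeasurable]

end Limit

/-- The estimator of the noise that reads `Z` off from the local inverse `H` of `f`. It is clipped
at `T`, and replaced by `0` on the flat sections. -/
def inversionEstimator (f : ℝ → ℝ) (H : ℝ × ℝ → ℝ) (T v : ℝ) : ℝ × ℝ → ℝ :=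
  {y | y.1 ∉ flatSet f ∧ (H y - √(1 - v) * y.1) / √v ∈ Metric.ball 0 T}.indicator
    fun y => (H y - √(1 - v) * y.1) / √v

/-- Where the inversion estimator is wrong in the limit `v → 0`. -/
def failureSet (f : ℝ → ℝ) (T : ℝ) : Set (ℝ × ℝ) :=
  flatSet f ×ˢ univ ∪ univ ×ˢ (Metric.ball 0 T)ᶜ

section Inversion

variable {f : ℝ → ℝ} {H : ℝ × ℝ → ℝ} {T : ℝ}

theorem measurableSet_failureSet (f : ℝ → ℝ) (T : ℝ) : MeasurableSet (failureSet f T) :=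
  ((measurableSet_flatSet f).prod .univ).union
    (MeasurableSet.univ.prod Metric.isOpen_ball.measurableSet.compl)

theorem measure_failureSet_le (f : ℝ → ℝ) (T : ℝ) :
    gauss.prod gaussSq (failureSet f T) ≤ gauss (flatSet f) + gaussSq (Metric.ball 0 T)ᶜ := by
  refine (measure_union_le _ _).trans ?_
  simp [Measure.prod_prod]

theorem lintegral_indicator_failureSet (f : ℝ → ℝ) (T : ℝ) :
    ∫⁻ p, (failureSet f T).indicator (fun p => ENNReal.ofReal (p.2 ^ 2)) p ∂(gauss.prod gauss) =
      gauss.prod gaussSq (failureSet f T) := by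
  rw [lintegral_indicator (measurableSet_failureSet f T), gaussSq,
    prod_withDensity_right (by fun_prop), withDensity_apply _ (measurableSet_failureSet f T)]

theorem measurable_inversionEstimator (f : ℝ → ℝ) (hH : Measurable H) (T v : ℝ) :
    Measurable (inversionEstimator f H T v) := by
  have hinv : Measurable fun y : ℝ × ℝ => (H y - √(1 - v) * y.1) / √v := by fun_prop
  exact hinv.indicator (((measurable_fst (measurableSet_flatSet f)).compl).inter
    (hinv Metric.isOpen_ball.measurableSet))

theorem abs_inversionEstimator_le (f : ℝ → ℝ) (H : ℝ × ℝ → ℝ) (hT : 0 ≤ T) (v : ℝ) (y : ℝ × ℝ) :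
    |inversionEstimator f H T v y| ≤ T := by
  by_cases hy : y.1 ∉ flatSet f ∧ (H y - √(1 - v) * y.1) / √v ∈ Metric.ball 0 T
  · rw [inversionEstimator, indicator_of_mem (by exact hy)]
    exact (mem_ball_zero_iff.1 hy.2).le
  · rw [inversionEstimator, indicator_of_notMem (by exact hy), abs_zero]
    exact hT

theorem inversionEstimator_eq_indicator {v a w : ℝ} (hv : 0 < v)
    (hH : H (a, f (√(1 - v) * a + √v * w)) = √(1 - v) * a + √v * w) :
    inversionEstimator f H T v (a, f (√(1 - v) * a + √v * w)) =
      (failureSet f T)ᶜ.indicator Prod.snd (a, w) := by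
  have hβ : √v ≠ 0 := (Real.sqrt_pos.2 hv).ne'
  have hinv : (√(1 - v) * a + √v * w - √(1 - v) * a) / √v = w := by field_simp; ring
  by_cases hw : a ∉ flatSet f ∧ w ∈ Metric.ball 0 T
  · rw [inversionEstimator, indicator_of_mem (by simpa only [mem_ofPred_eq, hH, hinv] using hw),
      indicator_of_mem (by simpa [failureSet] using hw), hH, hinv]
  · rw [inversionEstimator, indicator_of_notMem (by simpa only [mem_ofPred_eq, hH, hinv] using hw),
      indicator_of_notMem (by simpa [failureSet, imp_iff_not_or] using hw)]

theorem tendsto_sub_inversionEstimator_sq {a : ℝ}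
    (hH : a ∉ flatSet f → ∀ᶠ x in 𝓝 a, H (a, f x) = x) (T w : ℝ) :
    Tendsto (fun v => ENNReal.ofReal
        ((w - inversionEstimator f H T v (a, f (√(1 - v) * a + √v * w))) ^ 2)) (𝓝[>] 0)
      (𝓝 ((failureSet f T).indicator (fun p => ENNReal.ofReal (p.2 ^ 2)) (a, w))) := by
  by_cases ha : a ∈ flatSet f
  · simp [inversionEstimator, failureSet, ha]
  · have hx : Tendsto (fun v : ℝ => √(1 - v) * a + √v * w) (𝓝[>] 0) (𝓝 a) := by
      have hcont : Continuous fun v : ℝ => √(1 - v) * a + √v * w := by fun_prop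
      simpa using (hcont.tendsto 0).mono_left (nhdsWithin_le_nhds (s := Ioi (0 : ℝ)))
    refine tendsto_const_nhds.congr' ?_
    filter_upwards [hx.eventually (hH ha), self_mem_nhdsWithin] with v hv hv0
    rw [inversionEstimator_eq_indicator hv0 hv]
    by_cases hp : (a, w) ∈ failureSet f T <;> simp [hp]

theorem tendsto_normRisk_inversionEstimator (hf : Measurable f) (hH : Measurable H)
    (hinv : ∀ᵐ a : ℝ, a ∉ flatSet f → ∀ᶠ x in 𝓝 a, H (a, f x) = x) (hT : 0 ≤ T) :
    Tendsto (fun v => normRisk f v (inversionEstimator f H T v)) (𝓝[>] 0)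
      (𝓝 (gauss.prod gaussSq (failureSet f T))) := by
  rw [← lintegral_indicator_failureSet]
  refine tendsto_lintegral_filter_of_dominated_convergence
    (fun p => ENNReal.ofReal (2 * p.2 ^ 2 + 2 * T ^ 2)) ?_ ?_ ?_ ?_
  · exact .of_forall fun v =>
      measurable_normRisk_integrand hf v (measurable_inversionEstimator f hH T v)
  · refine .of_forall fun v => .of_forall fun p => ENNReal.ofReal_le_ofReal ?_
    have hbound := sq_le_sq' (neg_le_of_abs_le (abs_inversionEstimator_le f H hT v
      (p.1, f (√(1 - v) * p.1 + √v * p.2)))) (le_of_abs_le (abs_inversionEstimator_le f H hT v _))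
    nlinarith [sq_nonneg (p.2 + inversionEstimator f H T v
      (p.1, f (√(1 - v) * p.1 + √v * p.2)))]
  · have hint : Integrable (fun p : ℝ × ℝ => 2 * p.2 ^ 2 + 2 * T ^ 2) (gauss.prod gauss) :=
      ((memLp_two_id_gauss.integrable_sq.comp_snd gauss).const_mul 2).add (integrable_const _)
    exact hint.lintegral_lt_top.ne
  · have hae := (gaussianReal_absolutelyContinuous 0 one_ne_zero).ae_le hinv
    filter_upwards [Measure.quasiMeasurePreserving_fst.ae hae] with p hp
    exact tendsto_sub_inversionEstimator_sq hp T p.2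

end Inversion

section Slope

variable {f : ℝ → ℝ}

theorem eventually_lt_mmseZ_div (hf : Measurable f) {ρ : ℝ≥0∞} (hρ : ρ < gauss (flatSet f)) :
    ∀ᶠ v : ℝ in 𝓝[>] 0, ρ < mmseZ f (ENNReal.ofReal v) / ENNReal.ofReal v := by
  by_contra hcon
  obtain ⟨v, hv, hvρ⟩ := exists_seq_forall_of_frequently
    ((not_eventually.1 hcon).and_eventually (Ioc_mem_nhdsGT one_pos))
  choose g hg hgv using fun n => exists_mul_normRisk_eq_mmseZ hf (hvρ n).2.1 (hvρ n).2.2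
  have hle : ∀ n, normRisk f (v n) (g n) ≤ ρ := fun n => by
    have h := not_lt.1 (hvρ n).1
    rwa [← hgv n, mul_comm, ENNReal.mul_div_cancel_right
      (by simpa using (hvρ n).2.1) ENNReal.ofReal_ne_top] at h
  refine hρ.not_ge ((le_liminf_normRisk hf (hv.mono_right nhdsWithin_le_nhds) hg).trans ?_)
  exact (liminf_le_liminf (.of_forall hle)).trans_eq (liminf_const _)

theorem eventually_mmseZ_div_lt (hf : PiecewiseSmooth f) {ρ : ℝ≥0∞} (hρ : gauss (flatSet f) < ρ) :
    ∀ᶠ v : ℝ in 𝓝[>] 0, mmseZ f (ENNReal.ofReal v) / ENNReal.ofReal v < ρ := by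
  have htail : Tendsto (fun n : ℕ => gauss (flatSet f) + gaussSq (Metric.ball 0 n)ᶜ) atTop
      (𝓝 (gauss (flatSet f))) := by
    simp_rw [prob_compl_eq_one_sub (μ := gaussSq) Metric.isOpen_ball.measurableSet]
    simpa using tendsto_const_nhds.add (ENNReal.Tendsto.sub tendsto_const_nhds
      (tendsto_measure_ball_nat gaussSq 0) (Or.inl ENNReal.one_ne_top))
  obtain ⟨n, hn⟩ := (htail.eventually_lt_const hρ).exists
  obtain ⟨H, hH, hinv⟩ := hf.exists_local_inverse
  have hlim := tendsto_normRisk_inversionEstimator hf.measurable hH hinv n.cast_nonneg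
  filter_upwards [hlim.eventually_lt_const ((measure_failureSet_le f n).trans_lt hn),
    Ioc_mem_nhdsGT one_pos] with v hv hv01
  refine lt_of_le_of_lt (ENNReal.div_le_of_le_mul' ?_) hv
  exact mmseZ_le_mul_normRisk hf.measurable hv01.1 hv01.2
    (measurable_inversionEstimator f hH n v)

theorem tendsto_mmseZ_div (hf : PiecewiseSmooth f) :
    Tendsto (fun v : ℝ => mmseZ f (ENNReal.ofReal v) / ENNReal.ofReal v) (𝓝[>] 0)
      (𝓝 (gauss (flatSet f))) :=
  tendsto_order.2 ⟨fun _ h => eventually_lt_mmseZ_div hf.measurable h,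
    fun _ h => eventually_mmseZ_div_lt hf h⟩

end Slope

/-! ### Linearization of the state evolution at zero -/

theorem extrinsic_div (m : ℝ≥0∞) {v : ℝ≥0∞} (hv : v ≠ 0) (hv' : v ≠ ⊤) :
    extrinsic m v / v = extrinsic (m / v) 1 := by
  rw [extrinsic, extrinsic, div_eq_mul_inv, ← ENNReal.mul_inv (Or.inr hv') (Or.inr hv),
    ENNReal.sub_mul fun _ _ => hv', ENNReal.inv_mul_cancel hv hv', inv_one,
    ENNReal.inv_div (Or.inl hv') (Or.inl hv), div_eq_mul_inv, mul_comm]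

theorem continuous_extrinsic_left (v : ℝ≥0∞) : Continuous fun m => extrinsic m v :=
  continuous_inv.comp ((ENNReal.continuous_sub_right _).comp continuous_inv)

theorem extrinsic_inv_one (δ : ℝ) :
    extrinsic (ENNReal.ofReal δ)⁻¹ 1 = (ENNReal.ofReal (δ - 1))⁻¹ := by
  rw [extrinsic, inv_inv, inv_one, ENNReal.ofReal_sub _ zero_le_one, ENNReal.ofReal_one]

theorem one_add_extrinsic_one {p q : ℝ≥0∞} (h : p + q = 1) : 1 + extrinsic p 1 = q⁻¹ := by
  have hp : p ≠ ⊤ := ne_top_of_le_ne_top ENNReal.one_ne_top (le_self_add.trans_eq h)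
  have hq : q ≠ ⊤ := ne_top_of_le_ne_top ENNReal.one_ne_top (le_add_self.trans_eq h)
  rcases eq_or_ne p 0 with rfl | hp0
  · simp [extrinsic, (zero_add q).symm.trans h]
  rcases eq_or_ne q 0 with rfl | hq0
  · simp [extrinsic, (add_zero p).symm.trans h]
  have hodds : p⁻¹ - 1 = q / p := by
    rw [← one_div, ← h, ENNReal.add_div, ENNReal.div_self hp0 hp, h]
    exact ENNReal.add_sub_cancel_left ENNReal.one_ne_top
  rw [extrinsic, inv_one, hodds, ENNReal.inv_div (Or.inl hp) (Or.inl hp0),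
    ← ENNReal.div_self hq0 hq, ← ENNReal.add_div, add_comm, h, one_div]

/-- The slope of `phi` at `0`. -/
def phiSlope (f : ℝ → ℝ) : ℝ≥0∞ := extrinsic (gauss (flatSet f)) 1

theorem one_add_phiSlope (f : ℝ → ℝ) : 1 + phiSlope f = (gauss (flatSet f)ᶜ)⁻¹ :=
  one_add_extrinsic_one <| by rw [measure_add_measure_compl (measurableSet_flatSet f), measure_univ]

section PhiSlope

variable {f : ℝ → ℝ}

theorem tendsto_phi_div (hf : PiecewiseSmooth f) :
    Tendsto (fun v => phi f v / v) (𝓝[>] 0) (𝓝 (phiSlope f)) := by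
  have htoReal : Tendsto ENNReal.toReal (𝓝[>] 0) (𝓝[>] 0) := by
    refine tendsto_nhdsWithin_iff.2 ⟨?_, ?_⟩
    · simpa using (ENNReal.tendsto_toReal ENNReal.zero_ne_top).mono_left nhdsWithin_le_nhds
    · filter_upwards [Ioo_mem_nhdsGT ENNReal.zero_lt_top] with v hv
        using ENNReal.toReal_pos hv.1.ne' hv.2.ne
  refine (((continuous_extrinsic_left 1).tendsto _).comp
    ((tendsto_mmseZ_div hf).comp htoReal)).congr' ?_
  filter_upwards [Ioo_mem_nhdsGT ENNReal.zero_lt_top] with v hv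
  simp only [Function.comp_apply, ENNReal.ofReal_toReal hv.2.ne, phi_of_ne_zero f hv.1.ne',
    extrinsic_div _ hv.1.ne' hv.2.ne]

theorem eventually_mul_le_phi (hf : PiecewiseSmooth f) {c : ℝ≥0∞} (hc : c < phiSlope f) :
    ∀ᶠ v in 𝓝 0, c * v ≤ phi f v := by
  filter_upwards [eventually_nhdsWithin_iff.1 ((tendsto_phi_div hf).eventually_const_lt hc)]
    with v hv
  rcases eq_or_ne v 0 with rfl | hv0
  · simp
  · exact ENNReal.mul_le_of_le_div (hv (pos_iff_ne_zero.2 hv0)).le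

theorem phi_zero_of_eventually_le_mul (hf : Measurable f) {c : ℝ≥0∞} (hc : c ≠ ⊤)
    (h : ∀ᶠ v in 𝓝[>] 0, phi f v ≤ c * v) : phi f 0 = 0 := by
  have hlim : Tendsto (fun v => c * v) (𝓝[>] 0) (𝓝 0) := by
    simpa using ((ENNReal.continuous_const_mul hc).tendsto 0).mono_left nhdsWithin_le_nhds
  refine nonpos_iff_eq_zero.1 (ge_of_tendsto hlim ?_)
  filter_upwards [h, Ioc_mem_nhdsGT one_pos] with v hv hv1
  exact (phi_monotoneOn hf (mem_Iic.2 zero_le) hv1.2 zero_le).trans hv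

theorem eventually_phi_le_mul (hf : PiecewiseSmooth f) {c : ℝ≥0∞} (hc : phiSlope f < c)
    (hc' : c ≠ ⊤) : ∀ᶠ v in 𝓝 0, phi f v ≤ c * v := by
  have hpos : ∀ᶠ v in 𝓝[>] 0, phi f v ≤ c * v := by
    filter_upwards [(tendsto_phi_div hf).eventually_lt_const hc,
      Ioo_mem_nhdsGT ENNReal.zero_lt_top] with v hv hv0
    exact (ENNReal.div_le_iff hv0.1.ne' hv0.2.ne).1 hv.le
  filter_upwards [eventually_nhdsWithin_iff.1 hpos] with v hv
  rcases eq_or_ne v 0 with rfl | hv0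
  · simp [phi_zero_of_eventually_le_mul hf.measurable hc' hpos]
  · exact hv (pos_iff_ne_zero.2 hv0)

end PhiSlope

theorem Phi_div (P : Measure ℝ) (δ : ℝ) {v : ℝ≥0∞} (hv : v ≠ 0) (hv' : v ≠ ⊤) :
    Phi P δ v / v = extrinsic (lmmse P δ v / v) 1 := by
  rw [Phi_of_ne_zero P δ hv, extrinsic_div _ hv hv']

theorem lmmse_le (P : Measure ℝ) [IsProbabilityMeasure P] (δ : ℝ) (v : ℝ≥0∞) :
    lmmse P δ v ≤ (ENNReal.ofReal δ)⁻¹ * v := by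
  refine mul_le_mul_right ?_ _
  calc ∫⁻ x, (v⁻¹ + (ENNReal.ofReal x)⁻¹)⁻¹ ∂P ≤ ∫⁻ _, v ∂P :=
        lintegral_mono fun x => by rw [add_comm]; exact inv_add_inv_le_right _ _
    _ = v := by simp

theorem Phi_le_div (P : Measure ℝ) [IsProbabilityMeasure P] (δ : ℝ) {v : ℝ≥0∞} (hv : v ≠ ⊤) :
    Phi P δ v ≤ v / ENNReal.ofReal (δ - 1) := by
  rcases eq_or_ne v 0 with rfl | hv0
  · simp [Phi_zero]
  rw [div_eq_mul_inv, mul_comm, ← ENNReal.div_le_iff hv0 hv, Phi_div P δ hv0 hv,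
    ← extrinsic_inv_one]
  exact extrinsic_mono_left 1 (ENNReal.div_le_of_le_mul (lmmse_le P δ v))

theorem le_lmmse_div {P : Measure ℝ} [IsProbabilityMeasure P] {a : ℝ} (ha : ∀ᵐ x ∂P, a ≤ x)
    (δ : ℝ) {v : ℝ≥0∞} (hv : v ≠ 0) (hv' : v ≠ ⊤) :
    (ENNReal.ofReal δ)⁻¹ * (1 + v / ENNReal.ofReal a)⁻¹ ≤ lmmse P δ v / v := by
  rw [lmmse, mul_div_assoc]
  refine mul_le_mul_right ?_ _
  calc (1 + v / ENNReal.ofReal a)⁻¹ = (v⁻¹ + (ENNReal.ofReal a)⁻¹)⁻¹ / v := by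
        rw [div_eq_mul_inv (v⁻¹ + _)⁻¹, ← ENNReal.mul_inv (Or.inr hv') (Or.inr hv), add_mul,
          ENNReal.inv_mul_cancel hv hv', div_eq_mul_inv, mul_comm v]
    _ = (∫⁻ _, (v⁻¹ + (ENNReal.ofReal a)⁻¹)⁻¹ ∂P) / v := by simp
    _ ≤ _ := by
        refine ENNReal.div_le_div_right (lintegral_mono_ae ?_) _
        filter_upwards [ha] with x hx
        gcongr

theorem eventually_mul_le_Phi {P : Measure ℝ} (hP : IsEigenvalueLaw P) {δ : ℝ} {c : ℝ≥0∞}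
    (hc : c < (ENNReal.ofReal (δ - 1))⁻¹) : ∀ᶠ v in 𝓝 0, c * v ≤ Phi P δ v := by
  have := hP.1
  obtain ⟨a, b, ha, hab⟩ := hP.exists_ae_mem_Icc
  have hlim : Tendsto (fun v => extrinsic ((ENNReal.ofReal δ)⁻¹ * (1 + v / ENNReal.ofReal a)⁻¹) 1)
      (𝓝 0) (𝓝 (ENNReal.ofReal (δ - 1))⁻¹) := by
    have hdiv : Tendsto (fun v => (1 + v / ENNReal.ofReal a)⁻¹) (𝓝 0) (𝓝 1) := by
      have hcont : Continuous fun v => (1 + v / ENNReal.ofReal a)⁻¹ :=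
        continuous_inv.comp (continuous_const.add
          (ENNReal.continuous_div_const _ (ENNReal.ofReal_pos.2 ha).ne'))
      simpa using hcont.tendsto 0
    rw [← extrinsic_inv_one]
    refine ((continuous_extrinsic_left 1).tendsto _).comp ?_
    simpa using ENNReal.Tendsto.const_mul hdiv (Or.inl one_ne_zero)
  filter_upwards [hlim.eventually_const_lt hc, eventually_lt_nhds ENNReal.zero_lt_top] with v hv hv'
  rcases eq_or_ne v 0 with rfl | hv0
  · simp
  refine ENNReal.mul_le_of_le_div (hv.le.trans ?_)
  rw [Phi_div P δ hv0 hv'.ne]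
  exact extrinsic_mono_left 1 (le_lmmse_div (hab.mono fun x hx => hx.1) δ hv0 hv'.ne)

/-! ### The threshold from the linearization -/

section Threshold

variable {f : ℝ → ℝ} {ν : Measure ℝ} {δ : ℝ}

theorem exists_le_Phi_phi (hf : PiecewiseSmooth f) {P : Measure ℝ} (hP : IsEigenvalueLaw P)
    (hδ : 1 ≤ δ) (h : ENNReal.ofReal (δ - 1) < phiSlope f) :
    ∃ u ≠ 0, u ≤ 1 ∧ u ≤ Phi P δ (phi f u) := by
  have := hP.1
  obtain ⟨c, hδc, hcf⟩ := exists_between h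
  have hc0 : c ≠ 0 := hδc.ne_bot
  have hc : c ≠ ⊤ := hcf.ne_top
  have hmul : Tendsto (fun v => c * v) (𝓝 0) (𝓝 0) := by
    simpa using (ENNReal.continuous_const_mul hc).tendsto 0
  have hev := ((eventually_mul_le_phi hf hcf).and
    (hmul.eventually (eventually_mul_le_Phi hP (ENNReal.inv_lt_inv.2 hδc)))).filter_mono
    (nhdsWithin_le_nhds (s := Ioi 0))
  obtain ⟨u, ⟨hphi, hPhi⟩, hu⟩ := (hev.and (Ioc_mem_nhdsGT one_pos)).exists
  refine ⟨u, hu.1.ne', hu.2, ?_⟩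
  calc u = c⁻¹ * (c * u) := by rw [← mul_assoc, ENNReal.inv_mul_cancel hc0 hc, one_mul]
    _ ≤ Phi P δ (c * u) := hPhi
    _ ≤ Phi P δ (phi f u) := Phi_monotone hδ hphi

theorem le_vrStar (hf : Measurable f) (hν : IsEigenvalueLaw ν) (hδ : 1 ≤ δ) {u : ℝ≥0∞}
    (hu1 : u ≤ 1) (hu : u ≤ Phi (spectrumAt ν δ) δ (phi f u)) : u ≤ vrStar f ν δ := by
  have := (hν.spectrumAt (one_pos.trans_le hδ)).1
  have hle : ∀ t, u ≤ seVr f ν δ t := by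
    intro t
    induction t with
    | zero => exact hu1
    | succ t ih =>
      exact hu.trans (Phi_monotone hδ (phi_monotoneOn hf hu1 (seVr_le_one f hν hδ t) ih))
  exact le_limsup_of_frequently_le (Frequently.of_forall hle) (by isBoundedDefault)

theorem mseStar_ne_zero (hf : PiecewiseSmooth f) (hν : IsEigenvalueLaw ν) (hδ : 1 ≤ δ)
    (h : ENNReal.ofReal (δ - 1) < phiSlope f) : mseStar f ν δ ≠ 0 := by
  have hδ0 : 0 < δ := one_pos.trans_le hδ
  obtain ⟨u, hu0, hu1, hu⟩ := exists_le_Phi_phi hf (hν.spectrumAt hδ0) hδ h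
  have hphi : phi f u ≤ phi f (vrStar f ν δ) := phi_monotoneOn hf.measurable hu1
    (vrStar_le_one f hν hδ) (le_vrStar hf.measurable hν hδ hu1 hu)
  rw [Ne, mseStar_eq_zero_iff f hν hδ0]
  intro h0
  rw [h0, nonpos_iff_eq_zero] at hphi
  rw [hphi, Phi_zero, nonpos_iff_eq_zero] at hu
  exact hu0 hu

theorem ofReal_eq_one_add (hδ : 1 ≤ δ) : ENNReal.ofReal δ = 1 + ENNReal.ofReal (δ - 1) := by
  rw [← ENNReal.ofReal_one, ← ENNReal.ofReal_add zero_le_one (sub_nonneg.2 hδ), add_sub_cancel]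

theorem le_threshold (hf : PiecewiseSmooth f) (hν : IsEigenvalueLaw ν) :
    (gauss (flatSet f)ᶜ)⁻¹ ≤ threshold f ν := by
  refine le_sInf ?_
  rintro _ ⟨δ, ⟨hδ, h0⟩, rfl⟩
  by_contra! hlt
  rw [← one_add_phiSlope, ofReal_eq_one_add hδ.le,
    ENNReal.add_lt_add_iff_left ENNReal.one_ne_top] at hlt
  exact mseStar_ne_zero hf hν hδ.le hlt h0

theorem seVr_succ_le (hν : IsEigenvalueLaw ν) (hδ : 1 < δ) {c r : ℝ≥0∞} (hr : r ≠ ⊤)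
    (hc : c ≤ ENNReal.ofReal (δ - 1)) (hphi : ∀ v ≤ r, phi f v ≤ c * v)
    (h1 : seVr f ν δ 1 ≤ r) (n : ℕ) :
    seVr f ν δ (n + 1) ≤ (c / ENNReal.ofReal (δ - 1)) ^ n * r := by
  have := (hν.spectrumAt (one_pos.trans hδ)).1
  have hq : c / ENNReal.ofReal (δ - 1) ≤ 1 := ENNReal.div_le_of_le_mul (by rwa [one_mul])
  have hctop : c ≠ ⊤ := ne_top_of_le_ne_top ENNReal.ofReal_ne_top hc
  induction n with
  | zero => simpa using h1
  | succ n ih =>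
    have hle : seVr f ν δ (n + 1) ≤ r := ih.trans (mul_le_of_le_one_left' (pow_le_one' hq n))
    have hstep : phi f (seVr f ν δ (n + 1)) ≤ c * seVr f ν δ (n + 1) := hphi _ hle
    calc seVr f ν δ (n + 1 + 1)
        ≤ phi f (seVr f ν δ (n + 1)) / ENNReal.ofReal (δ - 1) :=
          Phi_le_div _ δ (ne_top_of_le_ne_top
            (ENNReal.mul_ne_top hctop (ne_top_of_le_ne_top hr hle)) hstep)
      _ ≤ c * seVr f ν δ (n + 1) / ENNReal.ofReal (δ - 1) := ENNReal.div_le_div_right hstep _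
      _ = c / ENNReal.ofReal (δ - 1) * seVr f ν δ (n + 1) := by
          rw [div_eq_mul_inv, div_eq_mul_inv, mul_right_comm]
      _ ≤ c / ENNReal.ofReal (δ - 1) * ((c / ENNReal.ofReal (δ - 1)) ^ n * r) := by gcongr
      _ = _ := by rw [← mul_assoc, pow_succ']

theorem mseStar_eq_zero (hν : IsEigenvalueLaw ν) (hδ : 1 < δ) {c r : ℝ≥0∞} (hr : r ≠ ⊤)
    (hc : c < ENNReal.ofReal (δ - 1)) (hphi : ∀ v ≤ r, phi f v ≤ c * v)
    (h1 : seVr f ν δ 1 ≤ r) : mseStar f ν δ = 0 := by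
  have hq : c / ENNReal.ofReal (δ - 1) < 1 := ENNReal.div_lt_of_lt_mul (by rwa [one_mul])
  have hgeom : Tendsto (fun n => (c / ENNReal.ofReal (δ - 1)) ^ n * r) atTop (𝓝 0) := by
    simpa using ENNReal.Tendsto.mul_const (ENNReal.tendsto_pow_atTop_nhds_zero_of_lt_one hq)
      (Or.inr hr)
  have hlim : Tendsto (seVr f ν δ) atTop (𝓝 0) := (tendsto_add_atTop_iff_nat 1).1 <|
    tendsto_of_tendsto_of_tendsto_of_le_of_le tendsto_const_nhds hgeom (fun _ => zero_le)
      (seVr_succ_le hν hδ hr hc.le hphi h1)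
  rw [mseStar_eq_zero_iff f hν (one_pos.trans hδ), vrStar, hlim.limsup_eq]
  simpa using hphi 0 zero_le

end Threshold

/-! ### Two-atom spectra -/

/-- The law with an atom of mass `p` at `a` and an atom of mass `1 - p` at `b`. -/
def twoAtoms (p a b : ℝ) : Measure ℝ :=
  ENNReal.ofReal p • Measure.dirac a + ENNReal.ofReal (1 - p) • Measure.dirac b

theorem lintegral_twoAtoms (p a b : ℝ) (g : ℝ → ℝ≥0∞) :
    ∫⁻ x, g x ∂(twoAtoms p a b) = ENNReal.ofReal p * g a + ENNReal.ofReal (1 - p) * g b := by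
  simp [twoAtoms, lintegral_smul_measure]

section TwoAtoms

variable {p a b : ℝ}

theorem isEigenvalueLaw_twoAtoms (hp : 0 ≤ p) (hp1 : p ≤ 1) (ha : 0 < a) (hab : a ≤ b) :
    IsEigenvalueLaw (twoAtoms p a b) := by
  refine ⟨⟨?_⟩, a, b, ha, ?_⟩
  · rw [← lintegral_one, lintegral_twoAtoms, mul_one, mul_one,
      ← ENNReal.ofReal_add hp (sub_nonneg.2 hp1), add_sub_cancel, ENNReal.ofReal_one]
  · simp [twoAtoms, hab]

theorem integral_twoAtoms (hp : 0 ≤ p) (hp1 : p ≤ 1) :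
    ∫ x, x ∂(twoAtoms p a b) = p * a + (1 - p) * b := by
  have hdirac c : Integrable (fun x : ℝ => x) (Measure.dirac c) := integrable_dirac (by simp)
  rw [twoAtoms, integral_add_measure ((hdirac a).smul_measure ENNReal.ofReal_ne_top)
    ((hdirac b).smul_measure ENNReal.ofReal_ne_top), integral_smul_measure, integral_smul_measure,
    integral_dirac, integral_dirac, ENNReal.toReal_ofReal hp,
    ENNReal.toReal_ofReal (sub_nonneg.2 hp1), smul_eq_mul, smul_eq_mul]

end TwoAtoms

theorem spectrumAt_eq_self {ν : Measure ℝ} {δ : ℝ} (hδ : δ ≠ 0) (h : ∫ x, x ∂ν = δ) :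
    spectrumAt ν δ = ν := by
  simp [spectrumAt, h, div_self hδ]

theorem lmmse_twoAtoms_le (p a b δ : ℝ) (v : ℝ≥0∞) : lmmse (twoAtoms p a b) δ v ≤
    (ENNReal.ofReal δ)⁻¹ * (ENNReal.ofReal p * ENNReal.ofReal a + ENNReal.ofReal (1 - p) * v) := by
  rw [lmmse, lintegral_twoAtoms]
  gcongr
  · exact inv_add_inv_le_right _ _
  · rw [add_comm]
    exact inv_add_inv_le_right _ _

/-- The small atom makes the error small, the rare large one only carries the mean. -/
theorem tendsto_Phi_twoAtoms {δ : ℝ} (hδ : 0 < δ) {v : ℝ≥0∞} (hv : v ≠ ⊤) (b : ℝ → ℝ) :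
    Tendsto (fun η => Phi (twoAtoms (1 - η) η (b η)) δ v) (𝓝[>] 0) (𝓝 0) := by
  rcases eq_or_ne v 0 with rfl | hv0
  · simpa only [Phi_zero] using tendsto_const_nhds
  simp only [Phi_of_ne_zero _ δ hv0]
  have hbound : Tendsto (fun η => (ENNReal.ofReal δ)⁻¹ *
      (ENNReal.ofReal (1 - η) * ENNReal.ofReal η + ENNReal.ofReal (1 - (1 - η)) * v))
      (𝓝[>] 0) (𝓝 0) := by
    have hη : Tendsto ENNReal.ofReal (𝓝[>] 0) (𝓝 0) := by
      simpa using (ENNReal.continuous_ofReal.tendsto 0).mono_left nhdsWithin_le_nhds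
    have hone : Tendsto (fun η => ENNReal.ofReal (1 - η)) (𝓝[>] 0) (𝓝 1) := by
      have hcont : Continuous fun η : ℝ => ENNReal.ofReal (1 - η) :=
        ENNReal.continuous_ofReal.comp (by fun_prop)
      simpa using (hcont.tendsto 0).mono_left nhdsWithin_le_nhds
    simpa [sub_sub_cancel] using ENNReal.Tendsto.const_mul
      ((ENNReal.Tendsto.mul hone (Or.inl one_ne_zero) hη (Or.inr ENNReal.one_ne_top)).add
        (ENNReal.Tendsto.mul_const hη (Or.inr hv)))
      (Or.inr (ENNReal.inv_ne_top.2 (ENNReal.ofReal_pos.2 hδ).ne'))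
  refine tendsto_of_tendsto_of_tendsto_of_le_of_le tendsto_const_nhds ?_ (fun _ => zero_le)
    fun η => extrinsic_mono_left v (lmmse_twoAtoms_le (1 - η) η (b η) δ v)
  have hzero : extrinsic 0 v = 0 := by
    rw [extrinsic, ENNReal.inv_zero, ENNReal.top_sub (ENNReal.inv_ne_top.2 hv0), ENNReal.inv_top]
  simpa only [hzero, Function.comp_def] using
    ((continuous_extrinsic_left v).tendsto 0).comp hbound

theorem exists_twoAtoms_seVr_le {f : ℝ → ℝ} (h1 : mmseZ f 1 < 1) {δ : ℝ} (hδ : 0 < δ)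
    {r : ℝ≥0∞} (hr : r ≠ 0) : ∃ p a b : ℝ, 0 < a ∧ a < b ∧ 0 < p ∧ p < 1 ∧
      seVr f (twoAtoms p a b) δ 1 ≤ r := by
  have hphi : phi f 1 ≠ ⊤ := by
    rw [phi_of_ne_zero _ one_ne_zero, extrinsic, ENNReal.inv_ne_top, inv_one]
    exact (tsub_pos_of_lt (ENNReal.one_lt_inv.2 h1)).ne'
  have hmin : 0 < min 1 δ := lt_min one_pos hδ
  obtain ⟨η, hη, hη0, hη1⟩ := (((tendsto_Phi_twoAtoms hδ hphi
    fun η => (δ - (1 - η) * η) / η).eventually_lt_const (pos_iff_ne_zero.2 hr)).and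
    (Ioo_mem_nhdsGT hmin)).exists
  have hηδ : η < δ := hη1.trans_le (min_le_right _ _)
  replace hη1 : η < 1 := hη1.trans_le (min_le_left _ _)
  have hmean : ∫ x, x ∂(twoAtoms (1 - η) η ((δ - (1 - η) * η) / η)) = δ := by
    rw [integral_twoAtoms (by linarith) (by linarith)]
    field_simp
    ring
  refine ⟨1 - η, η, (δ - (1 - η) * η) / η, hη0, ?_, by linarith, by linarith, ?_⟩
  · rw [lt_div_iff₀ hη0]
    linarith
  · rw [seVr, spectrumAt_eq_self hδ.ne' hmean]
    exact hη.le

theorem exists_twoAtoms_threshold_lt {f : ℝ → ℝ} (hf : PiecewiseSmooth f) (h1 : mmseZ f 1 < 1)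
    (hd : (gauss (flatSet f)ᶜ)⁻¹ < ⊤) {ε : ℝ≥0∞} (hε : 0 < ε) :
    ∃ p a b : ℝ, 0 < a ∧ a < b ∧ 0 < p ∧ p < 1 ∧
      threshold f (twoAtoms p a b) < (gauss (flatSet f)ᶜ)⁻¹ + ε := by
  obtain ⟨δ, -, hδ1, hδ2⟩ := ENNReal.lt_iff_exists_real_btwn.1
    (ENNReal.lt_add_right hd.ne hε.ne')
  have hδ : 1 < δ := by
    simpa using (ENNReal.one_le_inv.2 (prob_le_one (μ := gauss))).trans_lt hδ1
  rw [← one_add_phiSlope, ofReal_eq_one_add hδ.le,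
    ENNReal.add_lt_add_iff_left ENNReal.one_ne_top] at hδ1
  obtain ⟨c, hfc, hcδ⟩ := exists_between hδ1
  obtain ⟨r, hr, hphi⟩ : ∃ r : ℝ≥0∞, 0 < r ∧ ∀ v < r, phi f v ≤ c * v :=
    ENNReal.nhds_zero_basis.eventually_iff.1 (eventually_phi_le_mul hf hfc hcδ.ne_top)
  obtain ⟨s, hs0, hsr⟩ := exists_between hr
  obtain ⟨p, a, b, ha, hab, hp, hp1, hV⟩ :=
    exists_twoAtoms_seVr_le h1 (one_pos.trans hδ) hs0.ne'
  have hzero : mseStar f (twoAtoms p a b) δ = 0 :=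
    mseStar_eq_zero (isEigenvalueLaw_twoAtoms hp.le hp1.le ha hab.le) hδ hsr.ne_top hcδ
      (fun v hv => hphi v (hv.trans_lt hsr)) hV
  have hlt : threshold f (twoAtoms p a b) < (gauss (flatSet f)ᶜ)⁻¹ + ε :=
    sInf_lt_iff.2 ⟨_, mem_image_of_mem _ ⟨hδ, hzero⟩, hδ2⟩
  exact ⟨p, a, b, ha, hab, hp, hp1, hlt⟩

/-! ### Entropy of measures on the integers -/

theorem negMulLog_add_le {a b : ℝ} (ha : 0 ≤ a) (hb : 0 ≤ b) :
    Real.negMulLog (a + b) ≤ Real.negMulLog a + Real.negMulLog b := by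
  rcases ha.eq_or_lt with rfl | ha
  · simp
  rcases hb.eq_or_lt with rfl | hb
  · simp
  have hloga : Real.log a ≤ Real.log (a + b) := Real.log_le_log ha (by linarith)
  have hlogb : Real.log b ≤ Real.log (a + b) := Real.log_le_log hb (by linarith)
  simp only [Real.negMulLog]
  nlinarith

theorem sum_negMulLog_le {ι : Type*} (s : Finset ι) {a : ι → ℝ} (ha : ∀ i ∈ s, 0 ≤ a i) :
    ∑ i ∈ s, Real.negMulLog (a i) ≤
      (∑ i ∈ s, a i) * Real.log s.card + Real.negMulLog (∑ i ∈ s, a i) := by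
  rcases s.eq_empty_or_nonempty with rfl | hs
  · simp
  have hcard : (0 : ℝ) < s.card := by exact_mod_cast hs.card_pos
  have jensen := Real.concaveOn_negMulLog.le_map_sum (t := s) (w := fun _ => (s.card : ℝ)⁻¹)
    (p := a) (fun _ _ => by positivity) (by simp [hcard.ne']) ha
  simp only [smul_eq_mul, ← Finset.mul_sum] at jensen
  rw [Real.negMulLog_mul, Real.negMulLog, Real.log_inv] at jensen
  refine le_of_mul_le_mul_left (jensen.trans_eq ?_) (inv_pos.2 hcard)
  ring

theorem mul_log_le_negMulLog_add {a p c : ℝ} (ha : 0 ≤ a) (hap : a ≤ p) (hp : p ≤ 1)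
    (hc : 0 < c) (hac : a ≤ c⁻¹) : a * Real.log c ≤ Real.negMulLog p + p := by
  rcases ha.eq_or_lt with rfl | ha
  · rw [zero_mul]
    exact add_nonneg (Real.negMulLog_nonneg hap hp) hap
  have hp0 : 0 < p := ha.trans_le hap
  have hlogc : Real.log c ≤ -Real.log a := by
    rw [← Real.log_inv]
    exact Real.log_le_log hc ((le_inv_comm₀ hc ha).2 hac)
  have hlogp : Real.log p ≤ 0 := Real.log_nonpos hp0.le hp
  have hratio : a * (Real.log p - Real.log a) ≤ p - a := by
    have h := mul_le_mul_of_nonneg_left (Real.log_le_sub_one_of_pos (div_pos hp0 ha)) ha.le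
    rwa [Real.log_div hp0.ne' ha.ne', mul_sub_one, mul_div_cancel₀ _ ha.ne'] at h
  rw [Real.negMulLog]
  nlinarith

theorem ofReal_negMulLog_le_one {x : ℝ} (hx : 0 ≤ x) : ENNReal.ofReal (Real.negMulLog x) ≤ 1 :=
  ENNReal.ofReal_le_one.2 ((Real.negMulLog_le_one_sub_self hx).trans (sub_le_self 1 hx))

theorem tsum_measure_singleton {α : Type*} [MeasurableSpace α] [Countable α]
    [MeasurableSingletonClass α] (ρ : Measure α) : ∑' x, ρ {x} = ρ univ := by
  simpa only [indicator_univ] using Measure.tsum_indicator_apply_singleton ρ univ .univ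

theorem entropy_add_le (α β : Measure ℤ) [IsFiniteMeasure α] [IsFiniteMeasure β] :
    entropy (α + β) ≤ entropy α + entropy β := by
  simp only [entropy]
  rw [← ENNReal.tsum_add]
  refine ENNReal.tsum_le_tsum fun k => ?_
  rw [measureReal_add_apply]
  exact (ENNReal.ofReal_le_ofReal
    (negMulLog_add_le measureReal_nonneg measureReal_nonneg)).trans ENNReal.ofReal_add_le

theorem entropy_le_card {β : Measure ℤ} (S : Finset ℤ) (h : ∀ k ∉ S, β {k} = 0) :
    entropy β ≤ S.card := by
  rw [entropy, tsum_eq_sum (s := S) fun k hk => by simp [measureReal_def, h k hk]]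
  simpa using Finset.sum_le_card_nsmul S _ 1
    fun k _ => ofReal_negMulLog_le_one (measureReal_nonneg (μ := β) (s := {k}))

theorem entropy_le_entropy_add_card (α : Measure ℤ) {β : Measure ℤ} (S : Finset ℤ)
    (h : ∀ k ∉ S, β {k} = 0) : entropy α ≤ entropy (α + β) + S.card := by
  classical
  have hcard : (S.card : ℝ≥0∞) = ∑' k : ℤ, if k ∈ S then 1 else 0 := by
    rw [tsum_eq_sum (s := S) fun k hk => if_neg hk]
    simp
  rw [entropy, entropy, hcard, ← ENNReal.tsum_add]
  refine ENNReal.tsum_le_tsum fun k => ?_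
  by_cases hk : k ∈ S
  · rw [if_pos hk]
    exact (ofReal_negMulLog_le_one measureReal_nonneg).trans le_add_self
  · simp [measureReal_def, h k hk]

theorem sum_ofReal_negMulLog_le {ρ : Measure ℤ} (hρ : ρ univ ≤ 1) (s : Finset ℤ) {n : ℕ}
    (hn : s.card ≤ n) : ∑ k ∈ s, ENNReal.ofReal (Real.negMulLog (ρ.real {k})) ≤
      ρ s * ENNReal.ofReal (Real.log n) + ENNReal.ofReal (Real.negMulLog (ρ.real s)) := by
  have : IsFiniteMeasure ρ := ⟨hρ.trans_lt ENNReal.one_lt_top⟩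
  have hle (t : Set ℤ) : ρ.real t ≤ 1 :=
    ENNReal.toReal_le_of_le_ofReal zero_le_one
      (by simpa using (measure_mono (subset_univ t)).trans hρ)
  have hlog : Real.log s.card ≤ Real.log n := by
    rcases s.eq_empty_or_nonempty with rfl | hs
    · simpa using Real.log_natCast_nonneg n
    · exact Real.log_le_log (by exact_mod_cast hs.card_pos) (by exact_mod_cast hn)
  rw [← ENNReal.ofReal_sum_of_nonneg fun k _ =>
      Real.negMulLog_nonneg measureReal_nonneg (hle {k}),
    ← ofReal_measureReal (μ := ρ), ← ENNReal.ofReal_mul measureReal_nonneg]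
  refine (ENNReal.ofReal_le_ofReal ?_).trans ENNReal.ofReal_add_le
  have h := sum_negMulLog_le s fun k _ => measureReal_nonneg (μ := ρ) (s := {k})
  rw [sum_measureReal_singleton] at h
  linarith [mul_le_mul_of_nonneg_left hlog (measureReal_nonneg (μ := ρ) (s := s))]

theorem entropy_le_entropy_map_add {ρ : Measure ℤ} (hρ : ρ univ ≤ 1) {g : ℤ → ℤ}
    {F : ℤ → Finset ℤ} (hF : ∀ i, (F i : Set ℤ) = g ⁻¹' {i}) {n : ℕ} (hn : ∀ i, (F i).card ≤ n) :
    entropy ρ ≤ ρ univ * ENNReal.ofReal (Real.log n) + entropy (ρ.map g) := by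
  have hg : Measurable g := measurable_of_countable g
  have hmap i : (ρ.map g) {i} = ρ (F i) := by
    rw [hF, Measure.map_apply hg (measurableSet_singleton i)]
  calc entropy ρ = ∑' i, ∑ k ∈ F i, ENNReal.ofReal (Real.negMulLog (ρ.real {k})) := by
        rw [entropy, ← ENNReal.tsum_fiberwise _ g]
        refine tsum_congr fun i => ?_
        rw [← hF]
        exact Finset.tsum_subtype' (F i) fun k => ENNReal.ofReal (Real.negMulLog (ρ.real {k}))
    _ ≤ ∑' i, (ρ (F i) * ENNReal.ofReal (Real.log n) +
          ENNReal.ofReal (Real.negMulLog (ρ.real (F i)))) :=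
        ENNReal.tsum_le_tsum fun i => sum_ofReal_negMulLog_le hρ (F i) (hn i)
    _ = ρ univ * ENNReal.ofReal (Real.log n) + entropy (ρ.map g) := by
        simp only [entropy, measureReal_def, ← hmap]
        rw [ENNReal.tsum_add, ENNReal.tsum_mul_right, tsum_measure_singleton,
          Measure.map_apply hg .univ, preimage_univ]

theorem entropy_le_entropy_map_div_add {ρ : Measure ℤ} (hρ : ρ univ ≤ 1) {M : ℕ} (hM : 0 < M) :
    entropy ρ ≤
      ρ univ * ENNReal.ofReal (Real.log M) + entropy (ρ.map fun k => k / (M : ℤ)) := by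
  refine entropy_le_entropy_map_add hρ (F := fun i => Finset.Ico (i * M) (i * M + M))
    (fun i => ?_) fun i => by simp
  ext k
  simp [Int.ediv_eq_iff_of_pos (Int.natCast_pos.2 hM)]

theorem mul_log_le_entropy_add_one {ρ α : Measure ℤ} [IsProbabilityMeasure ρ] (hα : α ≤ ρ)
    {c : ℝ} (hc : 0 < c) (h : ∀ k, α.real {k} ≤ c⁻¹) :
    α univ * ENNReal.ofReal (Real.log c) ≤ entropy ρ + 1 := by
  have : IsFiniteMeasure α := isFiniteMeasure_of_le ρ hα
  rw [← tsum_measure_singleton α, ← ENNReal.tsum_mul_right, ← measure_univ (μ := ρ),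
    ← tsum_measure_singleton ρ, entropy, ← ENNReal.tsum_add]
  refine ENNReal.tsum_le_tsum fun k => ?_
  rw [← ofReal_measureReal (μ := α), ← ofReal_measureReal (μ := ρ),
    ← ENNReal.ofReal_mul measureReal_nonneg,
    ← ENNReal.ofReal_add (Real.negMulLog_nonneg measureReal_nonneg measureReal_le_one)
      measureReal_nonneg]
  exact ENNReal.ofReal_le_ofReal (mul_log_le_negMulLog_add measureReal_nonneg
    (ENNReal.toReal_mono (measure_ne_top ρ _) (hα {k})) measureReal_le_one hc (h k))

/-! ### Quantization and Rényi's theorem -/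

theorem measurable_floor_mul (M : ℕ) : Measurable fun x : ℝ => ⌊(M : ℝ) * x⌋ :=
  Int.measurable_floor.comp (by fun_prop)

instance isFiniteMeasure_quantizedLaw (μ : Measure ℝ) [IsFiniteMeasure μ] (M : ℕ) :
    IsFiniteMeasure (quantizedLaw μ M) :=
  inferInstanceAs (IsFiniteMeasure (μ.map _))

theorem quantizedLaw_univ (μ : Measure ℝ) (M : ℕ) : quantizedLaw μ M univ = μ univ := by
  rw [quantizedLaw, Measure.map_apply (measurable_floor_mul M) .univ, preimage_univ]

theorem quantizedLaw_add (μ ν : Measure ℝ) (M : ℕ) :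
    quantizedLaw (μ + ν) M = quantizedLaw μ M + quantizedLaw ν M :=
  Measure.map_add _ _ (measurable_floor_mul M)

theorem quantizedLaw_map_div (μ : Measure ℝ) {M : ℕ} (hM : 0 < M) :
    (quantizedLaw μ M).map (fun k => k / (M : ℤ)) = quantizedLaw μ 1 := by
  have hM' : (M : ℝ) ≠ 0 := by exact_mod_cast hM.ne'
  rw [quantizedLaw, Measure.map_map (measurable_of_countable _) (measurable_floor_mul M),
    quantizedLaw]
  congr 1
  funext x
  rw [Function.comp_apply, ← Int.floor_div_natCast, mul_div_cancel_left₀ _ hM', Nat.cast_one,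
    one_mul]

theorem quantizedLaw_singleton_eq_zero {μ : Measure ℝ} {S : Finset ℝ} (hS : μ (S : Set ℝ)ᶜ = 0)
    (M : ℕ) {k : ℤ} (hk : k ∉ S.image fun x : ℝ => ⌊(M : ℝ) * x⌋) :
    quantizedLaw μ M {k} = 0 := by
  rw [quantizedLaw, Measure.map_apply (measurable_floor_mul M) (measurableSet_singleton k)]
  exact measure_mono_null (fun x hx hxS => hk (Finset.mem_image.2 ⟨x, hxS, hx⟩)) hS

theorem entropy_quantizedLaw_add_le {μc μd : Measure ℝ} [IsFiniteMeasure μd]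
    (hμc : μc univ ≤ 1) {S : Finset ℝ} (hS : μd (S : Set ℝ)ᶜ = 0) {M : ℕ} (hM : 0 < M) :
    entropy (quantizedLaw (μc + μd) M) ≤ μc univ * ENNReal.ofReal (Real.log M) +
      (entropy (quantizedLaw (μc + μd) 1) + S.card + S.card) := by
  have : IsFiniteMeasure μc := ⟨hμc.trans_lt ENNReal.one_lt_top⟩
  have hdiscrete : entropy (quantizedLaw μd M) ≤ S.card :=
    (entropy_le_card _ fun k hk => quantizedLaw_singleton_eq_zero hS M hk).trans
      (Nat.cast_le.2 Finset.card_image_le)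
  have hrefine : entropy (quantizedLaw μc M) ≤
      μc univ * ENNReal.ofReal (Real.log M) + entropy (quantizedLaw μc 1) := by
    simpa only [quantizedLaw_map_div μc hM, quantizedLaw_univ] using
      entropy_le_entropy_map_div_add ((quantizedLaw_univ μc M).trans_le hμc) hM
  have hunit : entropy (quantizedLaw μc 1) ≤ entropy (quantizedLaw (μc + μd) 1) + S.card := by
    rw [quantizedLaw_add]
    refine (entropy_le_entropy_add_card _ _ fun k hk =>
      quantizedLaw_singleton_eq_zero hS 1 hk).trans ?_
    gcongr
    exact Finset.card_image_le
  calc entropy (quantizedLaw (μc + μd) M)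
      ≤ entropy (quantizedLaw μc M) + entropy (quantizedLaw μd M) := by
        rw [quantizedLaw_add]
        exact entropy_add_le _ _
    _ ≤ μc univ * ENNReal.ofReal (Real.log M) +
          (entropy (quantizedLaw (μc + μd) 1) + S.card) + S.card := by
        gcongr
        exact hrefine.trans (by gcongr)
    _ = _ := by rw [add_assoc]

theorem exists_le_smul_of_absolutelyContinuous {α : Type*} [MeasurableSpace α]
    {μ ν : Measure α} [SigmaFinite μ] [SigmaFinite ν] (hμ : μ ≪ ν) {b : ℝ≥0∞}
    (hb : b < μ univ) : ∃ (K : ℝ) (μ' : Measure α), 0 < K ∧ μ' ≤ μ ∧ b < μ' univ ∧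
      μ' ≤ ENNReal.ofReal K • ν := by
  set A : ℕ → Set α := fun n => {x | μ.rnDeriv ν x ≤ n}
  have hA : Monotone A := fun m n hmn x (hx : μ.rnDeriv ν x ≤ m) =>
    hx.trans (Nat.cast_le.2 hmn)
  have hUnion : μ (⋃ n, A n) = μ univ := by
    refine measure_congr (eventuallyEq_univ.2 ?_)
    filter_upwards [hμ.ae_le (Measure.rnDeriv_lt_top μ ν)] with x hx
    obtain ⟨n, hn⟩ := ENNReal.exists_nat_gt hx.ne
    exact mem_iUnion.2 ⟨n, hn.le⟩
  obtain ⟨n, hbn, hn⟩ := ((tendsto_measure_iUnion_atTop hA).eventually_const_lt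
    (hb.trans_eq hUnion.symm)).and (eventually_gt_atTop 0) |>.exists
  refine ⟨n, μ.restrict (A n), by exact_mod_cast hn, Measure.restrict_le_self, ?_,
    Measure.le_iff.2 fun s hs => ?_⟩
  · rwa [Measure.restrict_apply_univ]
  · rw [Measure.restrict_apply hs, ← Measure.setLIntegral_rnDeriv hμ, Measure.smul_apply,
      ENNReal.ofReal_natCast, smul_eq_mul]
    calc ∫⁻ x in s ∩ A n, μ.rnDeriv ν x ∂ν ≤ ∫⁻ _ in s ∩ A n, (n : ℝ≥0∞) ∂ν :=
          setLIntegral_mono measurable_const fun x hx => hx.2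
      _ = n * ν (s ∩ A n) := setLIntegral_const _ _
      _ ≤ n * ν s := by gcongr; exact inter_subset_left

theorem volume_floor_preimage {M : ℕ} (hM : 0 < M) (k : ℤ) :
    volume ((fun x : ℝ => ⌊(M : ℝ) * x⌋) ⁻¹' {k}) = ENNReal.ofReal (M : ℝ)⁻¹ := by
  have hM' : (0 : ℝ) < M := by exact_mod_cast hM
  have hcell : (fun x : ℝ => ⌊(M : ℝ) * x⌋) ⁻¹' {k} = Ico ((k : ℝ) / M) ((k + 1) / M) := by
    ext x
    simp only [mem_preimage, mem_singleton_iff, Int.floor_eq_iff, mem_Ico, div_le_iff₀ hM',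
      lt_div_iff₀ hM', mul_comm x]
  rw [hcell, Real.volume_Ico, add_div, add_sub_cancel_left, one_div]

theorem mul_log_le_entropy_quantizedLaw {μ ν : Measure ℝ} [IsProbabilityMeasure μ] (hν : ν ≤ μ)
    {K : ℝ} (hK : 0 < K) (hνK : ν ≤ ENNReal.ofReal K • volume) {M : ℕ} (hM : 0 < M) :
    ν univ * ENNReal.ofReal (Real.log (M / K)) ≤ entropy (quantizedLaw μ M) + 1 := by
  have hM' : (0 : ℝ) < M := by exact_mod_cast hM
  have : IsProbabilityMeasure (quantizedLaw μ M) :=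
    ⟨(quantizedLaw_univ μ M).trans measure_univ⟩
  rw [← quantizedLaw_univ ν M]
  refine mul_log_le_entropy_add_one (ρ := quantizedLaw μ M)
    (Measure.map_mono hν (measurable_floor_mul M)) (div_pos hM' hK)
    fun k => ENNReal.toReal_le_of_le_ofReal (by positivity) ?_
  rw [Measure.map_apply (measurable_floor_mul M) (measurableSet_singleton k)]
  refine (hνK _).trans_eq ?_
  rw [Measure.smul_apply, volume_floor_preimage hM, smul_eq_mul, ← ENNReal.ofReal_mul hK.le,
    inv_div, div_eq_mul_inv]

theorem tendsto_log_natCast_atTop : Tendsto (fun M : ℕ => Real.log M) atTop atTop :=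
  Real.tendsto_log_atTop.comp tendsto_natCast_atTop_atTop

theorem eventually_lt_entropy_div_log {μ μc : Measure ℝ} [IsProbabilityMeasure μ] (hμc : μc ≤ μ)
    (hac : μc ≪ volume) {b : ℝ≥0∞} (hb : b < μc univ) :
    ∀ᶠ M : ℕ in atTop, b < entropy (quantizedLaw μ M) / ENNReal.ofReal (Real.log M) := by
  have : IsFiniteMeasure μc := isFiniteMeasure_of_le μ hμc
  obtain ⟨K, ν, hK, hν, hbν, hνK⟩ := exists_le_smul_of_absolutelyContinuous hac hb
  have : IsFiniteMeasure ν := isFiniteMeasure_of_le μc hν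
  have hlim : Tendsto (fun M : ℕ => ENNReal.ofReal
      (ν.real univ - (ν.real univ * Real.log K + 1) / Real.log M)) atTop (𝓝 (ν univ)) := by
    rw [← ofReal_measureReal (μ := ν)]
    refine ENNReal.tendsto_ofReal ?_
    simpa using tendsto_const_nhds.sub
      (tendsto_log_natCast_atTop.const_div_atTop (ν.real univ * Real.log K + 1))
  filter_upwards [hlim.eventually_const_lt hbν, eventually_gt_atTop 0,
    tendsto_log_natCast_atTop.eventually_gt_atTop 0] with M hbM hM hlog
  refine hbM.trans_le ?_
  have hM' : (M : ℝ) ≠ 0 := by exact_mod_cast hM.ne'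
  have hscaled : ν.real univ - (ν.real univ * Real.log K + 1) / Real.log M =
      (ν.real univ * Real.log (M / K) - 1) / Real.log M := by
    rw [Real.log_div hM' hK.ne']
    field_simp
    ring
  rw [hscaled, ENNReal.ofReal_div_of_pos hlog, ENNReal.ofReal_sub _ zero_le_one,
    ENNReal.ofReal_one, ENNReal.ofReal_mul measureReal_nonneg, ofReal_measureReal]
  gcongr
  exact tsub_le_iff_right.2 (mul_log_le_entropy_quantizedLaw (hν.trans hμc) hK hνK hM)

theorem eventually_entropy_div_log_lt {μc μd : Measure ℝ} [IsFiniteMeasure μd]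
    (hμc : μc univ ≤ 1) {S : Finset ℝ} (hS : μd (S : Set ℝ)ᶜ = 0)
    (hH : entropy (quantizedLaw (μc + μd) 1) < ⊤) {b : ℝ≥0∞} (hb : μc univ < b) :
    ∀ᶠ M : ℕ in atTop,
      entropy (quantizedLaw (μc + μd) M) / ENNReal.ofReal (Real.log M) < b := by
  set C := entropy (quantizedLaw (μc + μd) 1) + S.card + S.card with hC
  have hCtop : C ≠ ⊤ := by simp [hC, hH.ne]
  have hlim : Tendsto (fun M : ℕ => μc univ + C / ENNReal.ofReal (Real.log M)) atTop
      (𝓝 (μc univ)) := by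
    simpa using tendsto_const_nhds.add (ENNReal.Tendsto.const_div
      (ENNReal.tendsto_ofReal_nhds_top.2 tendsto_log_natCast_atTop) (Or.inr hCtop))
  filter_upwards [hlim.eventually_lt_const hb, eventually_gt_atTop 0,
    tendsto_log_natCast_atTop.eventually_gt_atTop 0] with M hbM hM hlog
  refine lt_of_le_of_lt ?_ hbM
  rw [← ENNReal.mul_div_cancel_right (a := μc univ) (ENNReal.ofReal_pos.2 hlog).ne'
    ENNReal.ofReal_ne_top, ← ENNReal.add_div]
  exact ENNReal.div_le_div_right (entropy_quantizedLaw_add_le hμc hS hM) _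

theorem hasInfoDim_add {μc μd : Measure ℝ} [IsProbabilityMeasure (μc + μd)]
    (hac : μc ≪ volume) {S : Finset ℝ} (hS : μd (S : Set ℝ)ᶜ = 0)
    (hH : entropy (quantizedLaw (μc + μd) 1) < ⊤) : HasInfoDim (μc + μd) (μc univ) := by
  have hle : μc ≤ μc + μd := Measure.le_add_right le_rfl
  have : IsFiniteMeasure μd := isFiniteMeasure_of_le (μc + μd) (Measure.le_add_left le_rfl)
  exact tendsto_order.2 ⟨fun b hb => eventually_lt_entropy_div_log hle hac hb,
    fun b hb => eventually_entropy_div_log_lt ((hle univ).trans prob_le_one) hS hH hb⟩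

/-! ### The information dimension of `f(Z)` -/

section InfoDim

variable {f : ℝ → ℝ}

theorem PiecewiseSmooth.exists_finset_ae_mem (hf : PiecewiseSmooth f) :
    ∃ S : Finset ℝ, ∀ᵐ x : ℝ, x ∈ flatSet f → f x ∈ S := by
  classical
  obtain ⟨K, U, hU, -, hae, hk⟩ := hf.exists_open_pieces
  have hvalue k : ∃ c : ℝ, InjOn f (U k) ∨ ∀ x ∈ U k, f x = c :=
    (hk k).2.elim (fun hinj => ⟨0, Or.inl hinj⟩) fun ⟨c, hc⟩ => ⟨c, Or.inr hc⟩
  choose c hc using hvalue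
  refine ⟨Finset.univ.image c, ?_⟩
  filter_upwards [hae] with x ⟨k, hxk⟩ hx
  rcases hc k with hinj | hconst
  · exact absurd hx (notMem_flatSet_of_injOn (hU k) hinj hxk)
  · rw [hconst x hxk]
    exact Finset.mem_image_of_mem c (Finset.mem_univ k)

theorem ae_deriv_eq_zero_of_volume_image_eq_zero {s : Set ℝ} (hs : MeasurableSet s)
    (hinj : InjOn f s) (hf : ∀ x ∈ s, DifferentiableAt ℝ f x) (h0 : volume (f '' s) = 0) :
    ∀ᵐ x : ℝ, x ∈ s → deriv f x = 0 := by
  have harea := lintegral_image_eq_lintegral_abs_deriv_mul hs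
    (fun x hx => (hf x hx).hasDerivAt.hasDerivWithinAt) hinj fun _ => 1
  simp only [mul_one, setLIntegral_const, h0, mul_zero] at harea
  filter_upwards [(ae_restrict_iff' hs).1
    ((lintegral_eq_zero_iff (by fun_prop)).1 harea.symm)] with x hx hxs
  simpa using hx hxs

theorem PiecewiseSmooth.map_restrict_absolutelyContinuous (hf : PiecewiseSmooth f)
    (hr : NonflatRegular f) : (gauss.restrict (flatSet f)ᶜ).map f ≪ volume := by
  obtain ⟨K, U, hU, -, hae, hk⟩ := hf.exists_open_pieces
  refine Measure.AbsolutelyContinuous.mk fun N hN hN0 => ?_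
  rw [Measure.map_apply hf.measurable hN, Measure.restrict_apply (hf.measurable hN)]
  refine gaussianReal_absolutelyContinuous 0 one_ne_zero (measure_eq_zero_iff_ae_notMem.2 ?_)
  have hpiece k : ∀ᵐ x : ℝ, x ∈ U k → f x ∈ N → x ∈ flatSet f := by
    rcases (hk k).2 with hinj | ⟨c, hc⟩
    · filter_upwards [hr, ae_deriv_eq_zero_of_volume_image_eq_zero
        ((hU k).measurableSet.inter (hf.measurable hN)) (hinj.mono inter_subset_left)
        (fun x hx => (hk k).1.differentiableAt ((hU k).mem_nhds hx.1))
        (measure_mono_null (image_subset_iff.2 inter_subset_right) hN0)] with x hxr hx hxU hxN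
      exact hxr (hx ⟨hxU, hxN⟩)
    · exact ae_of_all _ fun x hx _ => subset_flatSet_of_const (hU k) hc hx
  filter_upwards [hae, ae_all_iff.2 hpiece] with x ⟨k, hxk⟩ hx hmem
  exact hmem.2 (hx k hxk hmem.1)

theorem PiecewiseSmooth.hasInfoDim_map (hf : PiecewiseSmooth f) (hr : NonflatRegular f)
    (hH : entropy (quantizedLaw (gauss.map f) 1) < ⊤) :
    HasInfoDim (gauss.map f) (gauss (flatSet f)ᶜ) := by
  have hfm := hf.measurable
  obtain ⟨S, hS⟩ := hf.exists_finset_ae_mem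
  have hsplit : gauss.map f =
      (gauss.restrict (flatSet f)ᶜ).map f + (gauss.restrict (flatSet f)).map f := by
    rw [← Measure.map_add _ _ hfm, add_comm,
      Measure.restrict_add_restrict_compl (measurableSet_flatSet f)]
  have hdiscrete : (gauss.restrict (flatSet f)).map f (S : Set ℝ)ᶜ = 0 := by
    have hm : MeasurableSet (S : Set ℝ)ᶜ := S.measurableSet.compl
    rw [Measure.map_apply hfm hm, Measure.restrict_apply (hfm hm)]
    refine gaussianReal_absolutelyContinuous 0 one_ne_zero ?_
    exact measure_mono_null (fun x hx (h : _ → _) => hx.1 (h hx.2)) (ae_iff.1 hS)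
  have hmass : gauss (flatSet f)ᶜ = (gauss.restrict (flatSet f)ᶜ).map f univ := by
    rw [Measure.map_apply hfm .univ, preimage_univ, Measure.restrict_apply_univ]
  have : IsProbabilityMeasure (gauss.map f) :=
    Measure.isProbabilityMeasure_map hfm.aemeasurable
  rw [hsplit] at this hH ⊢
  rw [hmass]
  exact hasInfoDim_add (hf.map_restrict_absolutelyContinuous hr) hdiscrete hH

end InfoDim
end GLMEP

end

theorem mainTheorem1 (f : ℝ → ℝ) (hf : GLMEP.PiecewiseSmooth f)
    (hH : GLMEP.entropy (GLMEP.quantizedLaw ((gaussianReal 0 1).map f) 1) < ⊤) :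
    (∀ ν₁ ν₂ : Measure ℝ, GLMEP.IsEigenvalueLaw ν₁ → GLMEP.IsEigenvalueLaw ν₂ →
      GLMEP.Spikier ν₁ ν₂ → GLMEP.threshold f ν₁ ≤ GLMEP.threshold f ν₂) ∧
    (GLMEP.NonflatRegular f →
      ∃ d : ℝ≥0∞, GLMEP.HasInfoDim ((gaussianReal 0 1).map f) d ∧
        (GLMEP.mmseZ f 1 < 1 → d⁻¹ < ⊤ →
          ∀ ε : ℝ≥0∞, 0 < ε → ∃ ν : Measure ℝ, GLMEP.IsEigenvalueLaw ν ∧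
            (∃ a b p : ℝ, 0 < a ∧ a < b ∧ 0 < p ∧ p < 1 ∧
              ν = ENNReal.ofReal p • Measure.dirac a + ENNReal.ofReal (1 - p) • Measure.dirac b) ∧
            d⁻¹ ≤ GLMEP.threshold f ν ∧ GLMEP.threshold f ν < d⁻¹ + ε)) := by
  refine ⟨fun ν₁ ν₂ h₁ h₂ hs => GLMEP.threshold_le_of_spikier hf.measurable h₁ h₂ hs,
    fun hr => ⟨GLMEP.gauss (GLMEP.flatSet f)ᶜ, hf.hasInfoDim_map hr hH, fun hm hd ε hε => ?_⟩⟩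
  obtain ⟨p, a, b, ha, hab, hp, hp1, hlt⟩ := GLMEP.exists_twoAtoms_threshold_lt hf hm hd hε
  have hlaw := GLMEP.isEigenvalueLaw_twoAtoms hp.le hp1.le ha hab.le
  exact ⟨_, hlaw, ⟨a, b, p, ha, hab, hp, hp1, rfl⟩, GLMEP.le_threshold hf hlaw, hlt⟩
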